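/- **Proposition 5.1.** Let $\lambda,\mu,\xi,V>0$, $0<a\le 1$, $b=1-a$, and let $1\le M_1<M$ be integers. *Model.* Attacks occur at the points $t_1,t_2,\dots$ of a Poisson point process of rate $\lambda$ on $[0,\infty)$. The $k$-th attack destroys $n_k$ nodes, where the $n_k$ are iid with $P\{n_k=j\}=ab^{j-1}$, $j\ge1$; these nodes have total weight $w_k=\sum_{j=1}^{n_k}w_{jk}$, where the $w_{jk}$ are iid exponential with rate $\xi$. The process is observed at the times $\tau_0=0$ and $\tau_i=\Delta_1+\dots+\Delta_i$, where the $\Delta_i$ are iid exponential with rate $\mu$. The families $(t_k)$, $(n_k)$, $(w_{jk})$, $(\Delta_i)$ are mutually independent. Let $N_i$ be the total number of nodes and $W_i$ the total weight lost up to time $\tau_i$. Let $\mu_1=\inf\{i\ge0:N_i>M_1\}$, $\mu=\inf\{i\ge0:N_i>M\}$ (not to be confused with the rate $\mu$) and $\nu=\inf\{i\ge0:W_i>V\}$, with $\inf\emptyset=\infty$. *Notation.* Let $u,v,\theta\in\mathbb C$ with $|u|\le1$, $\mathrm{Re}\,v\ge0$, $\mathrm{Re}\,\theta\ge0$, and put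 $$c(\theta)=\frac{\lambda+b\theta}{\lambda+\theta},\qquad d(\theta)=\frac{\lambda+b(\mu+\theta)}{\lambda+\mu+\theta},\qquad r_k^j(u,v,\theta)=e^{-(v+\xi)V}\sum_{i=k}^j\frac{[\xi d(\theta)uV]^i}{i!},$$ and $P(x,y)=1-\Gamma(x,y)/\Gamma(x)$ with the incomplete gamma function $\Gamma(x,y)=\int_y^\infty s^{x-1}e^{-s}\,ds$; in particular $P(0,y)=1$. For integers $1\le K_1<K$ put, if $K>K_1+1$, $$G(K_1,K)=\frac{a\lambda\mu\,c(\theta)^{K_1-1}(u\xi)^{K_1}}{(\mu+\theta+\lambda)(\theta+\lambda)\bigl(v+\xi(1-d(\theta)u)\bigr)}\left[\frac{P(K_1-1,(v+\xi)V)}{(v+\xi)^{K_1-1}}-\frac{r_{K_1-1}^{K-2}(u,v,\theta)}{(d(\theta)u\xi)^{K_1-1}}-\frac{(d(\theta)u\xi)^{K-K_1}P(K-1,(v+\xi)V)}{(v+\xi)^{K-1}}\right]$$ (read as its limit $0$ if $u=0$), and, if $K=K_1+1$, $$G(K_1,K_1+1)=\frac{a\lambda\mu\,c(\theta)^{K_1-1}(u\xi)^{K_1}}{(\mu+\theta+\lambda)(\theta+\lambda)(v+\xi)^{K_1}}\,P(K_1,(v+\xi)V).$$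 *Claim.* The random variable $u^{N_{\mu_1}}e^{-vW_{\mu_1}}e^{-\theta\tau_{\mu_1}}\mathbf 1_{\{\mu_1<\min(\mu,\nu)\}}$ is integrable and $$E\left[u^{N_{\mu_1}}e^{-vW_{\mu_1}}e^{-\theta\tau_{\mu_1}}\mathbf 1_{\{\mu_1<\min(\mu,\nu)\}}\right]=G(M_1+1,M+1).$$ If instead a node level counts as crossed once it is reached, i.e. $\mu_1=\inf\{i\ge0:N_i\ge M_1\}$ and $\mu=\inf\{i\ge0:N_i\ge M\}$ (with $\nu$ as before), then the variable is integrable and its expectation is $G(M_1,M)$. In both cases the first expression for $G$ applies if $M>M_1+1$ and the second one if $M=M_1+1$. -/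

import Mathlib

open MeasureTheory ProbabilityTheory Set

noncomputable section

namespace CyberAttack

variable {Ω : Type*} [MeasurableSpace Ω]

/-- The number of the points `t 0 ω, t 1 ω, …` that lie in `B`. -/
def pointCount (t : ℕ → Ω → ℝ) (B : Set ℝ) (ω : Ω) : ℕ := {k | t k ω ∈ B}.ncard

/-- The random points `t 0, t 1, …` form a Poisson point process of rate `lam` on `[0, ∞)`:
the number of points in a Borel set of finite length is finite a.s. and Poisson distributed with
parameter `lam` times the length, and the numbers of points in disjoint sets are independent. -/
structure IsPoissonProcess (P : Measure Ω) (lam : ℝ) (t : ℕ → Ω → ℝ) : Prop where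
  measurable : ∀ k, Measurable (t k)
  nonneg : ∀ᵐ ω ∂P, ∀ k, 0 ≤ t k ω
  locallyFinite : ∀ B : Set ℝ, MeasurableSet B → B ⊆ Ici 0 → volume B ≠ ⊤ →
    ∀ᵐ ω ∂P, {k | t k ω ∈ B}.Finite
  count_law : ∀ B : Set ℝ, MeasurableSet B → B ⊆ Ici 0 → volume B ≠ ⊤ →
    HasLaw (pointCount t B) (poissonMeasure (lam * (volume B).toReal).toNNReal) P
  count_indep : ∀ (m : ℕ) (B : Fin m → Set ℝ), (∀ i, MeasurableSet (B i)) →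
    (∀ i, B i ⊆ Ici 0) → (∀ i, volume (B i) ≠ ⊤) → (Pairwise fun i j => Disjoint (B i) (B j)) →
    iIndepFun (fun i => pointCount t (B i)) P

/-- Attacks at the times `t k` destroy `n k` nodes each; the nodes lost in the `k`-th attack have
weights `w k 0, …, w k (n k - 1)`. `D 0` is the first observation time and `D i`, `i ≥ 1`, are the
times between successive observations. The attack times are Poisson of rate `lam`, the times
between observations are iid exponential(`mu`), the numbers of nodes are iid geometric(`a`)
on `1, 2, …`, the weights are iid exponential(`xi`), the first observation takes place at time `0`
(no initial damage), and the four families are mutually independent. -/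
structure IsModelTwo (P : Measure Ω) (lam mu a xi : ℝ) (t : ℕ → Ω → ℝ) (n : ℕ → Ω → ℕ)
    (w : ℕ → ℕ → Ω → ℝ) (D : ℕ → Ω → ℝ) : Prop where
  attacks : IsPoissonProcess P lam t
  nodes_measurable : ∀ k, Measurable (n k)
  nodes_law : ∀ k j, P {ω | n k ω = j + 1} = ENNReal.ofReal (a * (1 - a) ^ j)
  nodes_indep : iIndepFun n P
  weights_measurable : ∀ k j, Measurable (w k j)
  weights_law : ∀ k j, HasLaw (w k j) (expMeasure xi) P
  weights_indep : iIndepFun (fun (p : ℕ × ℕ) => w p.1 p.2) P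
  obs_measurable : ∀ i, Measurable (D i)
  obs_zero : ∀ᵐ ω ∂P, D 0 ω = 0
  obs_law : ∀ i, HasLaw (D (i + 1)) (expMeasure mu) P
  obs_indep : iIndepFun D P
  indep_attacks : IndepFun (fun ω k => t k ω)
    (fun ω => ((fun k => n k ω : ℕ → ℕ), (fun k j => w k j ω : ℕ → ℕ → ℝ),
      (fun i => D i ω : ℕ → ℝ))) P
  indep_nodes : IndepFun (fun ω k => n k ω)
    (fun ω => ((fun k j => w k j ω : ℕ → ℕ → ℝ), (fun i => D i ω : ℕ → ℝ))) P
  indep_weights : IndepFun (fun ω k j => w k j ω) (fun ω i => D i ω) P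

/-- The observation times `τ_i = D_0 + … + D_i`. -/
def obsTime (D : ℕ → Ω → ℝ) (i : ℕ) (ω : Ω) : ℝ := ∑ j ∈ Finset.range (i + 1), D j ω

/-- The time window of the `i`-th increment: `[0, τ_0]`, and `(τ_{i-1}, τ_i]` for `i ≥ 1`. -/
def window (D : ℕ → Ω → ℝ) : ℕ → Ω → Set ℝ
  | 0, ω => Icc 0 (obsTime D 0 ω)
  | i + 1, ω => Ioc (obsTime D i ω) (obsTime D (i + 1) ω)

/-- `X_i`, the number of nodes lost in the `i`-th window. -/
def nodeIncrement (t : ℕ → Ω → ℝ) (n : ℕ → Ω → ℕ) (D : ℕ → Ω → ℝ) (i : ℕ) (ω : Ω) : ℕ :=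
  ∑' k, (window D i ω).indicator (fun _ => n k ω) (t k ω)

/-- `Y_i`, the total weight of the nodes lost in the `i`-th window. -/
def weightIncrement (t : ℕ → Ω → ℝ) (n : ℕ → Ω → ℕ) (w : ℕ → ℕ → Ω → ℝ) (D : ℕ → Ω → ℝ)
    (i : ℕ) (ω : Ω) : ℝ :=
  ∑' k, (window D i ω).indicator (fun _ => ∑ j ∈ Finset.range (n k ω), w k j ω) (t k ω)

/-- `N_i = X_0 + … + X_i`. -/
def nodeLoss (t : ℕ → Ω → ℝ) (n : ℕ → Ω → ℕ) (D : ℕ → Ω → ℝ) (i : ℕ) (ω : Ω) : ℕ :=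
  ∑ j ∈ Finset.range (i + 1), nodeIncrement t n D j ω

/-- `W_i = Y_0 + … + Y_i`. -/
def weightLoss (t : ℕ → Ω → ℝ) (n : ℕ → Ω → ℕ) (w : ℕ → ℕ → Ω → ℝ) (D : ℕ → Ω → ℝ)
    (i : ℕ) (ω : Ω) : ℝ :=
  ∑ j ∈ Finset.range (i + 1), weightIncrement t n w D j ω

/-- `inf {i ≥ 0 : x i > L}`, which is `∞` if there is no such `i`. -/
def exitIndex {α : Type*} [LT α] (x : ℕ → α) (L : α) : ℕ∞ :=
  sInf ((fun i : ℕ => (i : ℕ∞)) '' {i | L < x i})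

/-- `inf {i ≥ 0 : x i ≥ L}`, which is `∞` if there is no such `i`. -/
def reachIndex {α : Type*} [LE α] (x : ℕ → α) (L : α) : ℕ∞ :=
  sInf ((fun i : ℕ => (i : ℕ∞)) '' {i | L ≤ x i})

/-- The random variable `u^{N_{μ₁}} e^{-v W_{μ₁}} e^{-θ τ_{μ₁}} 1{μ₁ < min(μ, ν)}` for random indices
`μ₁ = i₁`, `μ = i₂`, `ν = i₃`. The value of `toNat` at `∞` plays no role: on the event, `i₁` is
finite. -/
def markedExit (t : ℕ → Ω → ℝ) (n : ℕ → Ω → ℕ) (w : ℕ → ℕ → Ω → ℝ) (D : ℕ → Ω → ℝ)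
    (i₁ i₂ i₃ : Ω → ℕ∞) (u v θ : ℂ) : Ω → ℂ :=
  {ω | i₁ ω < min (i₂ ω) (i₃ ω)}.indicator fun ω =>
    u ^ nodeLoss t n D (i₁ ω).toNat ω
      * Complex.exp (-v * (weightLoss t n w D (i₁ ω).toNat ω : ℂ))
      * Complex.exp (-θ * (obsTime D (i₁ ω).toNat ω : ℂ))

/-- `markedExit` for `μ₁ = inf {i : N_i > M₁}`, `μ = inf {i : N_i > M}`, `ν = inf {i : W_i > V}`. -/
def strictExit (t : ℕ → Ω → ℝ) (n : ℕ → Ω → ℕ) (w : ℕ → ℕ → Ω → ℝ) (D : ℕ → Ω → ℝ)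
    (M₁ M : ℕ) (V : ℝ) (u v θ : ℂ) : Ω → ℂ :=
  markedExit t n w D
    (fun ω => exitIndex (fun i => nodeLoss t n D i ω) M₁)
    (fun ω => exitIndex (fun i => nodeLoss t n D i ω) M)
    (fun ω => exitIndex (fun i => weightLoss t n w D i ω) V) u v θ

/-- `markedExit` for `μ₁ = inf {i : N_i ≥ M₁}`, `μ = inf {i : N_i ≥ M}`, `ν = inf {i : W_i > V}`. -/
def reachExit (t : ℕ → Ω → ℝ) (n : ℕ → Ω → ℕ) (w : ℕ → ℕ → Ω → ℝ) (D : ℕ → Ω → ℝ)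
    (M₁ M : ℕ) (V : ℝ) (u v θ : ℂ) : Ω → ℂ :=
  markedExit t n w D
    (fun ω => reachIndex (fun i => nodeLoss t n D i ω) M₁)
    (fun ω => reachIndex (fun i => nodeLoss t n D i ω) M)
    (fun ω => exitIndex (fun i => weightLoss t n w D i ω) V) u v θ

/-- The incomplete gamma function `Γ(x, y) = ∫_y^∞ s^{x-1} e^{-s} ds`, the path of integration being
the horizontal ray from `y`. -/
def incGamma (x y : ℂ) : ℂ :=
  ∫ s in Ioi (0 : ℝ), (y + (s : ℂ)) ^ (x - 1) * Complex.exp (-(y + (s : ℂ)))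

/-- The regularized gamma function `P(x, y) = 1 - Γ(x, y) / Γ(x)`. The factor `1 / Γ(x)` is the entire
function that vanishes at `x = 0`, so that `P(0, y) = 1`. -/
def regGamma (x y : ℂ) : ℂ := 1 - incGamma x y * (Complex.Gamma x)⁻¹

/-- `c(θ) = (λ + bθ) / (λ + θ)` with `b = 1 - a`. -/
def cCoef (lam a : ℝ) (θ : ℂ) : ℂ := (lam + (1 - a) * θ) / (lam + θ)

/-- `d(θ) = (λ + b(μ + θ)) / (λ + μ + θ)` with `b = 1 - a`. -/
def dCoef (lam mu a : ℝ) (θ : ℂ) : ℂ := (lam + (1 - a) * (mu + θ)) / (lam + mu + θ)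

/-- `r_k^j(u, v, θ) = e^{-(v+ξ)V} ∑_{i=k}^j [ξ d(θ) u V]^i / i!`. -/
def rSum (lam mu a xi V : ℝ) (k j : ℕ) (u v θ : ℂ) : ℂ :=
  Complex.exp (-(v + xi) * V) *
    ∑ i ∈ Finset.Icc k j, (xi * dCoef lam mu a θ * u * V) ^ i / (i.factorial : ℂ)

/-- The explicit expression for levels `K > K₁ + 1`. At `u = 0` it has the value `0`, which is also
its limit. -/
def gapFormula (lam mu a xi V : ℝ) (K₁ K : ℕ) (u v θ : ℂ) : ℂ :=
  a * lam * mu * cCoef lam a θ ^ (K₁ - 1) * (u * xi) ^ K₁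
      / ((mu + θ + lam) * (θ + lam) * (v + xi * (1 - dCoef lam mu a θ * u)))
    * (regGamma ((K₁ - 1 : ℕ) : ℂ) ((v + xi) * V) / (v + xi) ^ (K₁ - 1)
      - rSum lam mu a xi V (K₁ - 1) (K - 2) u v θ / (dCoef lam mu a θ * u * xi) ^ (K₁ - 1)
      - (dCoef lam mu a θ * u * xi) ^ (K - K₁) * regGamma ((K - 1 : ℕ) : ℂ) ((v + xi) * V)
          / (v + xi) ^ (K - 1))

/-- The explicit expression for levels `K = K₁ + 1`. -/
def adjacentFormula (lam mu a xi V : ℝ) (K₁ : ℕ) (u v θ : ℂ) : ℂ :=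
  a * lam * mu * cCoef lam a θ ^ (K₁ - 1) * (u * xi) ^ K₁
      / ((mu + θ + lam) * (θ + lam) * (v + xi) ^ K₁)
    * regGamma (K₁ : ℂ) ((v + xi) * V)

end CyberAttack

end

open CyberAttack

namespace CyberAttack

open Filter Asymptotics Topology

/-! Almost surely nothing is lost at time `0` and both losses are nondecreasing. The exit therefore
happens at observation `i + 1` exactly when `N_i ≤ L < N_{i+1} ≤ M` and `W_{i+1} ≤ V`, and the
marked variable is a series over `i` with at most one nonzero term (`IsRegular.hasSum_exitTerm`). It
is integrated term by term.

Fix the attack and observation times. The node numbers before and during the last window are then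
independent negative binomial variables. If `m` nodes are lost in all, their weight is gamma
distributed with shape `m`, however `m` splits between the windows; tilting by `e^{-vx}` and
truncating at `V` gives `(ξ/(v+ξ))^m P(m, (v+ξ)V)` (`IsModelTwo.integral_lossFactor`). Next the
times are averaged out. Poisson counts on adjacent intervals are independent and `τ_i` is
independent of `Δ_{i+1}`, so each term factors into a part from `τ_i` and a part from the last
window. Only the first part depends on `i`. The laws of `τ_1, τ_2, …` add up to `μ` times Lebesgue
measure, which turns the sum over `i` into a Laplace transform
(`IsModelTwo.hasSum_integral_nodeKernel`).

These transforms are geometric in the number of nodes, with ratio `c(θ)` before and `d(θ) = c(μ+θ)`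
during the last window (`nodeLaplace_succ`), and their convolution telescopes to a multiple of `c^L
d^{m-L-1}` (`sum_renewal_mul_increment`). What remains is a geometric sum of values `P(m, y)`,
evaluated by parts through `P(m+1, y) = P(m, y) - e^{-y} y^m/m!` (`sum_pow_mul_regGamma`). Reaching
an integer level is the same as exceeding its predecessor, so the second convention is the first one
with shifted levels. -/

/-! ### Incomplete gamma integrals with integer shape and complex rate -/

/-- The partial sum `∑_{i<n} z^i / i!` of the exponential series. -/
noncomputable def expPartial (n : ℕ) (z : ℂ) : ℂ := ∑ i ∈ Finset.range n, z ^ i / (i.factorial : ℂ)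

lemma expPartial_succ (n : ℕ) (z : ℂ) :
    expPartial (n + 1) z = expPartial n z + z ^ n / (n.factorial : ℂ) := by
  simp [expPartial, Finset.sum_range_succ]

lemma expPartial_zero (z : ℂ) : expPartial 0 z = 0 := by simp [expPartial]

lemma expPartial_succ_zero (n : ℕ) : expPartial (n + 1) 0 = 1 := by
  simp [expPartial, Finset.sum_range_succ']

lemma hasDerivAt_exp_neg_mul_expPartial (n : ℕ) (z : ℂ) :
    HasDerivAt (fun z => -(Complex.exp (-z) * expPartial (n + 1) z))
      (Complex.exp (-z) * z ^ n / (n.factorial : ℂ)) z := by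
  have he : HasDerivAt (fun z : ℂ => Complex.exp (-z)) (-Complex.exp (-z)) z := by
    simpa using (hasDerivAt_neg z).cexp
  induction n with
  | zero =>
    refine (he.neg.congr_deriv (by simp)).congr_of_eventuallyEq
      (Eventually.of_forall fun z => by simp [expPartial])
  | succ n ih =>
    have hp := (he.mul ((hasDerivAt_pow (n + 1) z).div_const ((n + 1).factorial : ℂ)))
    refine ((ih.sub hp).congr_deriv ?_).congr_of_eventuallyEq
      (Eventually.of_forall fun z => ?_)
    · have h1 : ((n + 1).factorial : ℂ) ≠ 0 := by exact_mod_cast (n + 1).factorial_ne_zero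
      have h2 : (n.factorial : ℂ) ≠ 0 := by exact_mod_cast n.factorial_ne_zero
      have h3 : ((n : ℂ) + 1) ≠ 0 := by exact_mod_cast n.succ_ne_zero
      rw [Nat.factorial_succ]
      push_cast
      field_simp
      ring
    · simp only [Pi.sub_apply, Pi.mul_apply]
      rw [expPartial_succ (n + 1)]
      ring

lemma hasDerivAt_exp_neg_mul_expPartial_affine (n : ℕ) (y β : ℂ) (s : ℝ) :
    HasDerivAt (fun s : ℝ => -(Complex.exp (-(y + β * s)) * expPartial (n + 1) (y + β * s)))
      (β * (Complex.exp (-(y + β * s)) * (y + β * s) ^ n / (n.factorial : ℂ))) s := by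
  have h1 : HasDerivAt (fun s : ℝ => y + β * (s : ℂ)) β s := by
    simpa using ((Complex.ofRealCLM.hasDerivAt (x := s)).const_mul β).const_add y
  have := (hasDerivAt_exp_neg_mul_expPartial n (y + β * s)).comp s h1
  rw [mul_comm β]
  exact this

lemma isBigO_exp_neg_mul_pow (n : ℕ) (y β : ℂ) (hβ : 0 < β.re) :
    (fun s : ℝ => Complex.exp (-(y + β * s)) * (y + β * s) ^ n)
      =O[atTop] fun s : ℝ => Real.exp (-(β.re / 2) * s) := by
  have hb : 0 < ‖β‖ := norm_pos_iff.2 fun h => by simp [h] at hβ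
  -- With this `c`, `x^n/n! ≤ e^x` at `x = c‖y + βs‖` bounds the power at the cost of half the decay
  -- rate `Re β`.
  set c : ℝ := β.re / 2 / ‖β‖ with hc
  have hc0 : 0 < c := by positivity
  refine IsBigO.of_bound (Real.exp (-y.re) * (n.factorial / c ^ n * Real.exp (c * ‖y‖))) ?_
  filter_upwards [eventually_ge_atTop 0] with s hs
  rw [norm_mul, norm_pow, Complex.norm_exp, Real.norm_eq_abs, Real.abs_exp]
  have h1 : ‖y + β * s‖ ≤ ‖y‖ + ‖β‖ * s := by
    refine (norm_add_le _ _).trans ?_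
    rw [norm_mul, Complex.norm_real, Real.norm_eq_abs, abs_of_nonneg hs]
  have h2 : ‖y + β * s‖ ^ n ≤ n.factorial / c ^ n * Real.exp (c * ‖y + β * s‖) := by
    have := Real.pow_div_factorial_le_exp (x := c * ‖y + β * s‖) (by positivity) n
    rw [div_le_iff₀ (by positivity), mul_pow] at this
    rw [div_mul_eq_mul_div, le_div_iff₀ (by positivity)]
    linarith
  have h3 : c * ‖y + β * s‖ ≤ c * ‖y‖ + β.re / 2 * s := by
    calc c * ‖y + β * s‖ ≤ c * (‖y‖ + ‖β‖ * s) := by gcongr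
      _ = c * ‖y‖ + β.re / 2 * s := by rw [hc]; field_simp
  have h4 : (-(y + β * s)).re = -y.re + -β.re * s := by simp [add_comm]
  rw [h4, Real.exp_add]
  calc Real.exp (-y.re) * Real.exp (-β.re * s) * ‖y + β * s‖ ^ n
      ≤ Real.exp (-y.re) * Real.exp (-β.re * s) *
        (n.factorial / c ^ n * Real.exp (c * ‖y‖ + β.re / 2 * s)) := by
        gcongr
        exact h2.trans (by gcongr)
    _ = _ := by
        rw [Real.exp_add]
        have : Real.exp (-(β.re / 2) * s) = Real.exp (-β.re * s) * Real.exp (β.re / 2 * s) := by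
          rw [← Real.exp_add]; ring_nf
        rw [this]; ring

lemma tendsto_exp_neg_mul_expPartial (n : ℕ) (y β : ℂ) (hβ : 0 < β.re) :
    Tendsto (fun s : ℝ => -(Complex.exp (-(y + β * s)) * expPartial n (y + β * s)))
      atTop (𝓝 0) := by
  have h0 : Tendsto (fun s : ℝ => Real.exp (-(β.re / 2) * s)) atTop (𝓝 0) := by
    refine Real.tendsto_exp_atBot.comp ?_
    exact tendsto_id.const_mul_atTop_of_neg (by linarith)
  have : ∀ i ∈ Finset.range n, Tendsto (fun s : ℝ => (Complex.exp (-(y + β * s)) *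
      (y + β * s) ^ i) * (i.factorial : ℂ)⁻¹) atTop (𝓝 0) := fun i _ => by
    simpa using ((isBigO_exp_neg_mul_pow i y β hβ).trans_tendsto h0).mul_const (i.factorial : ℂ)⁻¹
  have h := (tendsto_finsetSum _ this).neg
  simp only [Finset.sum_const_zero, neg_zero] at h
  refine h.congr fun s => ?_
  rw [expPartial, Finset.mul_sum]
  congr 1
  exact Finset.sum_congr rfl fun i _ => by rw [div_eq_mul_inv, mul_assoc]

lemma integrableOn_exp_neg_mul_pow (n : ℕ) (y β : ℂ) (hβ : 0 < β.re) :
    IntegrableOn (fun s : ℝ => Complex.exp (-(y + β * s)) * (y + β * s) ^ n) (Ioi 0) := by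
  have hc : Continuous fun s : ℝ => Complex.exp (-(y + β * s)) * (y + β * s) ^ n := by fun_prop
  rw [IntegrableOn, ← integrable_norm_iff hc.aestronglyMeasurable]
  exact integrable_of_isBigO_exp_neg (b := β.re / 2) (by positivity) hc.norm.continuousOn
    (isBigO_exp_neg_mul_pow n y β hβ).norm_left

/-- The fundamental theorem of calculus along the ray from `y` in direction `β`. The case `β = 1` is
the incomplete gamma function, the case `y = 0` a Laplace transform. -/
lemma integral_exp_neg_mul_pow (n : ℕ) (y β : ℂ) (hβ : 0 < β.re) :
    ∫ s in Ioi (0 : ℝ), β * (Complex.exp (-(y + β * s)) * (y + β * s) ^ n / (n.factorial : ℂ))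
      = Complex.exp (-y) * expPartial (n + 1) y := by
  rw [integral_Ioi_of_hasDerivAt_of_tendsto'
    (fun s _ => hasDerivAt_exp_neg_mul_expPartial_affine n y β s)
    (((integrableOn_exp_neg_mul_pow n y β hβ).div_const _).const_mul _)
    (tendsto_exp_neg_mul_expPartial (n + 1) y β hβ)]
  simp

/-- `∫₀^∞ s^n / n! e^{-βs} ds = β^{-(n+1)}` for complex `β` with positive real part. -/
lemma integral_pow_mul_exp_neg_Ioi (n : ℕ) (β : ℂ) (hβ : 0 < β.re) :
    ∫ s in Ioi (0 : ℝ), (s : ℂ) ^ n / (n.factorial : ℂ) * Complex.exp (-(β * s))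
      = (β ^ (n + 1))⁻¹ := by
  have hb : β ≠ 0 := fun h => by simp [h] at hβ
  have h := integral_exp_neg_mul_pow n 0 β hβ
  simp only [zero_add, neg_zero, Complex.exp_zero, expPartial_succ_zero, mul_one] at h
  rw [← mul_right_inj' (pow_ne_zero (n + 1) hb), ← integral_const_mul,
    mul_inv_cancel₀ (pow_ne_zero (n + 1) hb), ← h]
  congr 1 with s
  rw [mul_pow]
  ring

lemma integrableOn_pow_mul_exp_neg_Ioi (n : ℕ) (β : ℂ) (hβ : 0 < β.re) :
    IntegrableOn (fun s : ℝ => (s : ℂ) ^ n / (n.factorial : ℂ) * Complex.exp (-(β * s)))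
      (Ioi 0) := by
  have hb : β ≠ 0 := fun h => by simp [h] at hβ
  refine ((integrableOn_exp_neg_mul_pow n 0 β hβ).const_mul
    ((β ^ n)⁻¹ / (n.factorial : ℂ))).congr (Eventually.of_forall fun s => ?_)
  simp only [zero_add, mul_pow]
  field_simp

lemma integral_pow_mul_exp_neg_Ioc (n : ℕ) (β : ℂ) (hβ : 0 < β.re) (V : ℝ) (hV : 0 ≤ V) :
    ∫ s in Ioc (0 : ℝ) V, (s : ℂ) ^ n / (n.factorial : ℂ) * Complex.exp (-(β * s))
      = (1 - Complex.exp (-(β * V)) * expPartial (n + 1) (β * V)) * (β ^ (n + 1))⁻¹ := by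
  have hb : β ≠ 0 := fun h => by simp [h] at hβ
  have h := intervalIntegral.integral_eq_sub_of_hasDerivAt (a := 0) (b := V)
    (fun s _ => hasDerivAt_exp_neg_mul_expPartial_affine n 0 β s)
    (Continuous.intervalIntegrable (by fun_prop) _ _)
  simp only [zero_add, Complex.ofReal_zero, mul_zero, neg_zero, Complex.exp_zero,
    expPartial_succ_zero, mul_one] at h
  rw [intervalIntegral.integral_of_le hV] at h
  rw [eq_mul_inv_iff_mul_eq₀ (pow_ne_zero _ hb), ← integral_mul_const]
  refine Eq.trans ?_ (h.trans (by ring))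
  congr 1 with s
  rw [mul_pow]
  ring

/-- At positive integers the regularized gamma function is elementary. -/
lemma regGamma_natCast (n : ℕ) (y : ℂ) :
    regGamma n y = 1 - Complex.exp (-y) * expPartial n y := by
  cases n with
  -- `Complex.Gamma 0` and its inverse are `0` by convention, in agreement with the zero of the
  -- entire function `1/Γ`.
  | zero => simp [regGamma, expPartial_zero]
  | succ n =>
    have h := integral_exp_neg_mul_pow n y 1 (by simp)
    have hn : (n.factorial : ℂ) ≠ 0 := by exact_mod_cast n.factorial_ne_zero
    have hi : incGamma ((n + 1 : ℕ) : ℂ) y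
        = n.factorial * (Complex.exp (-y) * expPartial (n + 1) y) := by
      rw [← h, incGamma, ← integral_const_mul]
      congr 1 with s
      have : ((n + 1 : ℕ) : ℂ) - 1 = n := by push_cast; ring
      rw [this, Complex.cpow_natCast]
      field_simp
    rw [regGamma, hi]
    push_cast
    rw [Complex.Gamma_nat_eq_factorial]
    field_simp

/-! ### Negative binomial weights and their Laplace transforms -/

/-- The probability that `c` independent geometric(`a`) variables on `1, 2, …` add up to `k`. -/
noncomputable def negBin (a : ℝ) : ℕ → ℕ → ℝ
  | 0, 0 => 1
  | 0, _ + 1 => 0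
  | _ + 1, 0 => 0
  | c + 1, k + 1 => a * negBin a c k + (1 - a) * negBin a (c + 1) k

lemma negBin_eq_zero_of_lt (a : ℝ) : ∀ {c k : ℕ}, k < c → negBin a c k = 0
  | 0, _, h => absurd h (Nat.not_lt_zero _)
  | _ + 1, 0, _ => by simp [negBin]
  | c + 1, k + 1, h => by
    rw [negBin, negBin_eq_zero_of_lt a (Nat.lt_of_succ_lt_succ h),
      negBin_eq_zero_of_lt a ((Nat.lt_succ_self k).trans h)]
    ring

/-- The geometric distribution on `1, 2, …`. -/
noncomputable def geomWeight (a : ℝ) : ℕ → ℝ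
  | 0 => 0
  | j + 1 => a * (1 - a) ^ j

/-- The recursion for `negBin` asks whether the first variable stops at its first unit, with
probability `a`; iterating it over all values of that variable gives the convolution. -/
lemma sum_antidiagonal_geometric (a : ℝ) (c k : ℕ) :
    ∑ p ∈ Finset.HasAntidiagonal.antidiagonal k, a * (1 - a) ^ p.1 * negBin a c p.2 = negBin a (c + 1) (k + 1) := by
  induction k with
  | zero => simp [negBin]
  | succ k ih =>
    rw [Finset.Nat.antidiagonal_succ, Finset.sum_cons, Finset.sum_map, negBin, ← ih,
      Finset.mul_sum]
    simp only [pow_zero, mul_one, Function.Embedding.prodMap, Function.Embedding.coeFn_mk,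
      Prod.map_fst, Prod.map_snd, Nat.succ_eq_add_one, Function.Embedding.refl_apply]
    congr 1
    exact Finset.sum_congr rfl fun p _ => by rw [pow_succ]; ring

/-- The negative binomial weights are convolution powers of the geometric distribution. -/
lemma negBin_succ_eq_sum (a : ℝ) (c k : ℕ) :
    negBin a (c + 1) k = ∑ p ∈ Finset.HasAntidiagonal.antidiagonal k, geomWeight a p.1 * negBin a c p.2 := by
  cases k with
  | zero => simp [negBin, geomWeight]
  | succ k =>
    rw [← sum_antidiagonal_geometric, Finset.Nat.antidiagonal_succ, Finset.sum_cons, Finset.sum_map]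
    simp [geomWeight]

/-- The Laplace transform at `β` of the probability that the nodes lost up to time `s` number `k`,
as a function of `s`. -/
noncomputable def nodeLaplace (lam a : ℝ) (β : ℂ) (k : ℕ) : ℂ :=
  ∑ c ∈ Finset.range (k + 1), (negBin a c k : ℂ) * lam ^ c / (lam + β) ^ (c + 1)

lemma nodeLaplace_zero (lam a : ℝ) (β : ℂ) : nodeLaplace lam a β 0 = (lam + β)⁻¹ := by
  simp [nodeLaplace, negBin]

/-- The recursion for `negBin` becomes a first-order recursion in `k` with ratio `aλ/(λ+β) + (1-a) =
c(β)`. Its correction term, from zero attacks, is nonzero only at `k = 0`. -/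
lemma nodeLaplace_succ (lam a : ℝ) (β : ℂ) (hβ : (lam : ℂ) + β ≠ 0) (k : ℕ) :
    nodeLaplace lam a β (k + 1)
      = a * lam / (lam + β) ^ 2 * cCoef lam a β ^ k := by
  have hrec : ∀ k, nodeLaplace lam a β (k + 1) = a * lam / (lam + β) * nodeLaplace lam a β k
      + (1 - a) * (nodeLaplace lam a β k - negBin a 0 k / (lam + β)) := fun k => by
    have h1 : nodeLaplace lam a β k = ∑ c ∈ Finset.range (k + 1),
        (negBin a (c + 1) k : ℂ) * lam ^ (c + 1) / (lam + β) ^ (c + 1 + 1)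
          + negBin a 0 k / (lam + β) := by
      have : nodeLaplace lam a β k = ∑ c ∈ Finset.range (k + 1 + 1),
          (negBin a c k : ℂ) * lam ^ c / (lam + β) ^ (c + 1) := by
        rw [Finset.sum_range_succ, negBin_eq_zero_of_lt a (Nat.lt_succ_self k)]
        simp [nodeLaplace]
      rw [this, Finset.sum_range_succ']
      simp
    have h2 : nodeLaplace lam a β (k + 1) = ∑ c ∈ Finset.range (k + 1),
        (negBin a (c + 1) (k + 1) : ℂ) * lam ^ (c + 1) / (lam + β) ^ (c + 1 + 1) := by
      rw [nodeLaplace, Finset.sum_range_succ']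
      simp [negBin]
    rw [sub_eq_of_eq_add h1, h2]
    nth_rewrite 1 [nodeLaplace]
    rw [Finset.mul_sum, Finset.mul_sum, ← Finset.sum_add_distrib]
    refine Finset.sum_congr rfl fun c _ => ?_
    rw [negBin]
    push_cast
    field_simp
    ring
  induction k with
  | zero =>
    rw [hrec, nodeLaplace_zero]
    simp only [negBin, Complex.ofReal_one]
    field_simp
    ring
  | succ k ih =>
    have hc : cCoef lam a β = a * lam / (lam + β) + (1 - a) := by
      rw [cCoef]; field_simp; ring
    rw [hrec, ih, negBin, pow_succ (cCoef lam a β)]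
    nth_rewrite 4 [hc]
    simp only [Complex.ofReal_zero]
    ring

lemma dCoef_eq_cCoef (lam mu a : ℝ) (θ : ℂ) : dCoef lam mu a θ = cCoef lam a (mu + θ) := by
  rw [dCoef, cCoef, add_assoc]

/-- The convolution of the renewal sequence with the law of a single increment telescopes. -/
lemma sum_renewal_mul_increment (lam mu a : ℝ) (θ : ℂ) (h1 : (lam : ℂ) + θ ≠ 0)
    (h2 : (lam : ℂ) + (mu + θ) ≠ 0) (L r : ℕ) :
    ∑ k ∈ Finset.range (L + 1), ((if k = 0 then 1 else 0) + mu * nodeLaplace lam a θ k)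
        * (mu * nodeLaplace lam a (mu + θ) (L + 1 + r - k))
      = a * lam * mu / ((mu + θ + lam) * (θ + lam)) * cCoef lam a θ ^ L
          * dCoef lam mu a θ ^ r := by
  have h1' : θ + (lam : ℂ) ≠ 0 := by rwa [add_comm]
  have h2' : (mu : ℂ) + θ + lam ≠ 0 := by rwa [add_comm]
  rw [dCoef_eq_cCoef]
  -- The total `L + 1 + r` stays fixed: the step from `L` to `L + 1` at `r` uses the hypothesis at
  -- `r + 1`.
  induction L generalizing r with
  | zero =>
    rw [Finset.sum_range_one, if_pos rfl, nodeLaplace_zero, show 0 + 1 + r - 0 = r + 1 by omega,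
      nodeLaplace_succ _ _ _ h2]
    rw [add_comm (mu + θ) (lam : ℂ), add_comm θ (lam : ℂ)]
    field_simp
    ring
  | succ L ih =>
    have hs : ∀ k ∈ Finset.range (L + 1), L + 1 + 1 + r - k = L + 1 + (r + 1) - k := by
      intro k _; omega
    rw [Finset.sum_range_succ, Finset.sum_congr rfl (fun k hk => by rw [hs k hk]), ih,
      if_neg (Nat.succ_ne_zero L), show L + 1 + 1 + r - (L + 1) = r + 1 by omega,
      nodeLaplace_succ _ _ _ h1, nodeLaplace_succ _ _ _ h2]
    -- The new summand is a multiple of `c^L d^r (c - d)`, which replaces a factor `d` by a factor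
    -- `c`.
    have hcd : cCoef lam a θ - cCoef lam a (mu + θ)
        = a * lam * mu / ((lam + θ) * (lam + (mu + θ))) := by
      rw [cCoef, cCoef]
      field_simp
      ring
    have hA : a * lam * mu / ((lam + (mu + θ)) * (lam + θ))
          * (cCoef lam a θ - cCoef lam a (mu + θ))
        = mu * (a * lam / (lam + θ) ^ 2) * (mu * (a * lam / (lam + (mu + θ)) ^ 2)) := by
      rw [hcd]
      field_simp
    rw [add_comm (mu + θ) (lam : ℂ), add_comm θ (lam : ℂ), pow_succ (cCoef lam a θ) L,
      pow_succ (cCoef lam a (mu + θ)) r]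
    linear_combination -(cCoef lam a θ ^ L * cCoef lam a (mu + θ) ^ r) * hA

/-! ### Closed forms for the sum over the number of nodes at the exit -/

lemma regGamma_succ (n : ℕ) (y : ℂ) :
    regGamma ((n + 1 : ℕ) : ℂ) y
      = regGamma (n : ℂ) y - Complex.exp (-y) * (y ^ n / (n.factorial : ℂ)) := by
  rw [regGamma_natCast, regGamma_natCast, expPartial_succ]
  ring

/-- Summation by parts: apart from `P`, the summands are geometric with ratio `q/p`, and the
decrements of `P` are terms of the exponential series, whose powers of `p` cancel and leave the
series in `qV`. -/
lemma sum_pow_mul_regGamma (p q z V : ℂ) (d : ℂ) (hp : p ≠ 0) (hq : q ≠ 0) (hpq : p - q ≠ 0)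
    (hqd : q = d * z) (L J : ℕ) :
    ∑ j ∈ Finset.range J, d ^ j * (z / p) ^ (L + 1 + j) * regGamma ((L + 1 + j : ℕ) : ℂ) (p * V)
      = z ^ (L + 1) / (p - q) * (regGamma (L : ℂ) (p * V) / p ^ L
          - Complex.exp (-(p * V)) *
              (∑ i ∈ Finset.Ico L (L + J), (q * V) ^ i / (i.factorial : ℂ)) / q ^ L
          - q ^ J * regGamma ((L + J : ℕ) : ℂ) (p * V) / p ^ (L + J)) := by
  induction J with
  | zero => simp
  | succ J ih =>
    have hR : regGamma ((L + J : ℕ) : ℂ) (p * V) = regGamma ((L + J + 1 : ℕ) : ℂ) (p * V)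
        + Complex.exp (-(p * V)) * ((p * V) ^ (L + J) / ((L + J).factorial : ℂ)) := by
      rw [regGamma_succ]; ring
    have hf : ((L + J).factorial : ℂ) ≠ 0 := by exact_mod_cast (L + J).factorial_ne_zero
    rw [Finset.sum_range_succ, ih, ← Nat.add_assoc L J 1,
      Finset.sum_Ico_succ_top (Nat.le_add_right L J), hR,
      show L + 1 + J = L + J + 1 by omega]
    generalize regGamma ((L + J + 1 : ℕ) : ℂ) (p * V) = R
    generalize regGamma (L : ℂ) (p * V) = R₀
    generalize ∑ i ∈ Finset.Ico L (L + J), (q * V) ^ i / (i.factorial : ℂ) = S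
    generalize Complex.exp (-(p * V)) = e
    have hJ : d ^ J * (z / p) ^ (L + J + 1) = z ^ (L + 1) * q ^ J / p ^ (L + J + 1) := by
      rw [hqd, div_pow, mul_pow, pow_add z (L + J), pow_add z L J, pow_add z L 1]
      ring
    rw [hJ, mul_pow p V, mul_pow q V, pow_add q L J, pow_succ p (L + J), pow_succ q J]
    have hpL := pow_ne_zero L hp
    have hpLJ := pow_ne_zero (L + J) hp
    have hqL := pow_ne_zero L hq
    field_simp
    ring

/-- `d = (1-a) + aλ/(λ+μ+θ)`, and the second term is smaller than `a` because `Re(λ+μ+θ) > λ`. This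
keeps the denominator `v + ξ(1-du)` away from zero. -/
lemma norm_dCoef_lt_one (lam mu a : ℝ) (hlam : 0 < lam) (hmu : 0 < mu) (ha : 0 < a) (ha' : a ≤ 1)
    (θ : ℂ) (hθ : 0 ≤ θ.re) : ‖dCoef lam mu a θ‖ < 1 := by
  have hre : (lam + mu + θ : ℂ).re = lam + mu + θ.re := by simp
  have h0 : (lam + mu + θ : ℂ) ≠ 0 := fun h => by
    rw [h, Complex.zero_re] at hre; linarith
  have hn : lam + mu ≤ ‖(lam + mu + θ : ℂ)‖ := by
    have := Complex.re_le_norm (lam + mu + θ : ℂ); rw [hre] at this; linarith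
  have hd : dCoef lam mu a θ = (1 - a : ℝ) + (a * lam : ℝ) / (lam + mu + θ) := by
    rw [dCoef]; push_cast; field_simp; ring
  rw [hd]
  refine (norm_add_le _ _).trans_lt ?_
  rw [norm_div, Complex.norm_real, Complex.norm_real, Real.norm_of_nonneg (by linarith),
    Real.norm_of_nonneg (by positivity)]
  have : a * lam / ‖(lam + mu + θ : ℂ)‖ < a := by
    rw [div_lt_iff₀ (by linarith)]; nlinarith
  linarith

lemma dCoef_ne_zero (lam mu a : ℝ) (hlam : 0 < lam) (hmu : 0 < mu) (ha' : a ≤ 1)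
    (θ : ℂ) (hθ : 0 ≤ θ.re) : dCoef lam mu a θ ≠ 0 := by
  refine div_ne_zero (fun h => ?_) (fun h => ?_)
  · have := congrArg Complex.re h
    simp at this
    nlinarith [mul_nonneg (sub_nonneg.2 ha') (add_nonneg hmu.le hθ)]
  · have := congrArg Complex.re h
    simp at this
    linarith

/-- The expectation of the marked exit as a sum over the number of nodes lost at the exit. -/
noncomputable def exitSum (lam mu a xi V : ℝ) (L N : ℕ) (u v θ : ℂ) : ℂ :=
  ∑ m ∈ Finset.Ioc L N, a * lam * mu / ((mu + θ + lam) * (θ + lam)) * cCoef lam a θ ^ L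
    * dCoef lam mu a θ ^ (m - (L + 1)) * u ^ m * ((xi / (v + xi)) ^ m * regGamma m ((v + xi) * V))

lemma exitSum_succ (lam mu a xi V : ℝ) (L : ℕ) (u v θ : ℂ) :
    exitSum lam mu a xi V L (L + 1) u v θ = adjacentFormula lam mu a xi V (L + 1) u v θ := by
  have : Finset.Ioc L (L + 1) = {L + 1} := by ext; simp
  rw [exitSum, this, Finset.sum_singleton, adjacentFormula, Nat.add_sub_cancel, Nat.sub_self,
    pow_zero, mul_pow, div_pow]
  field_simp

/-- The gap expression also holds for adjacent levels, so no separation beyond `L < N` is needed. -/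
lemma exitSum_eq_gapFormula (lam mu a xi V : ℝ) (hlam : 0 < lam) (hmu : 0 < mu) (ha : 0 < a)
    (ha' : a ≤ 1) (hxi : 0 < xi) (L N : ℕ) (hLN : L < N)
    (u v θ : ℂ) (hu : ‖u‖ ≤ 1) (hv : 0 ≤ v.re) (hθ : 0 ≤ θ.re) :
    exitSum lam mu a xi V L N u v θ = gapFormula lam mu a xi V (L + 1) (N + 1) u v θ := by
  -- At `u = 0` the summation formula would divide by `q = 0`, but both sides vanish through a
  -- positive power of `u`.
  rcases eq_or_ne u 0 with rfl | hu0
  · rw [exitSum, gapFormula, Finset.sum_eq_zero]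
    · simp
    · intro m hm
      rw [Finset.mem_Ioc] at hm
      rw [zero_pow (by omega : m ≠ 0)]
      ring
  obtain ⟨J, rfl⟩ : ∃ J, N = L + J + 1 := ⟨N - L - 1, by omega⟩
  set d := dCoef lam mu a θ with hd
  have hp : v + xi ≠ 0 := fun h => by
    have := congrArg Complex.re h
    simp only [Complex.add_re, Complex.ofReal_re, Complex.zero_re] at this
    linarith
  have hxi0 : (xi : ℂ) ≠ 0 := by exact_mod_cast hxi.ne'
  have hq : d * u * xi ≠ 0 :=
    mul_ne_zero (mul_ne_zero (dCoef_ne_zero lam mu a hlam hmu ha' θ hθ) hu0) hxi0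
  -- Equality would contradict `|duξ| < ξ ≤ Re(v + ξ)`.
  have hpq : v + xi - d * u * xi ≠ 0 := fun h => by
    have h1 : ‖d * u * xi‖ < xi := by
      rw [norm_mul, norm_mul, Complex.norm_real, Real.norm_of_nonneg hxi.le]
      have h3 : ‖d‖ < 1 := norm_dCoef_lt_one lam mu a hlam hmu ha ha' θ hθ
      have h4 : ‖d‖ * ‖u‖ < 1 := by nlinarith [norm_nonneg d, norm_nonneg u]
      nlinarith
    have h2 := Complex.re_le_norm (d * u * xi)
    rw [← sub_eq_zero.1 h] at h1 h2
    simp only [Complex.add_re, Complex.ofReal_re] at h2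
    linarith
  have key := sum_pow_mul_regGamma (v + xi) (d * u * xi) (u * xi) V d hp hq hpq (by ring) L (J + 1)
  have hsum : exitSum lam mu a xi V L (L + J + 1) u v θ
      = a * lam * mu / ((mu + θ + lam) * (θ + lam)) * cCoef lam a θ ^ L
        * ∑ j ∈ Finset.range (J + 1), d ^ j * (u * xi / (v + xi)) ^ (L + 1 + j)
            * regGamma ((L + 1 + j : ℕ) : ℂ) ((v + xi) * V) := by
    have hI : Finset.Ioc L (L + J + 1) = Finset.Ico (L + 1) (L + 1 + (J + 1)) := by
      ext; simp; omega
    rw [exitSum, hI, Finset.sum_Ico_eq_sum_range, Nat.add_sub_cancel_left, Finset.mul_sum]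
    refine Finset.sum_congr rfl fun j _ => ?_
    rw [Nat.add_sub_cancel_left, mul_div_assoc u, mul_pow u, ← hd]
    ring
  have hIcc : Finset.Icc L (L + J) = Finset.Ico L (L + (J + 1)) := by ext; simp; omega
  rw [hsum, key, gapFormula, rSum, ← hd]
  simp only [Nat.add_sub_cancel]
  rw [show L + J + 1 + 1 - 2 = L + J by omega, show L + J + 1 + 1 - (L + 1) = J + 1 by omega, hIcc,
    show v + xi * (1 - d * u) = v + xi - d * u * xi by ring,
    show -(v + (xi : ℂ)) * V = -((v + xi) * V) by ring,
    show (xi : ℂ) * d * u * V = d * u * xi * V by ring, ← Nat.add_assoc L J 1]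
  generalize (mu + θ + lam) * (θ + lam) = D₁
  generalize v + xi - d * u * xi = D₂
  generalize regGamma (L : ℂ) ((v + xi) * V) / (v + xi) ^ L - _ - _ = B
  ring

/-! ### Gamma distributions with integer shape -/

/-- The density of the gamma distribution of shape `n + 1` and rate `r` on `(0, ∞)`. -/
noncomputable def erlangDensity (n : ℕ) (r x : ℝ) : ℝ :=
  r ^ (n + 1) / n.factorial * x ^ n * Real.exp (-(r * x))

lemma integral_gammaMeasure (n : ℕ) {r : ℝ} (hr : 0 < r) (h : ℝ → ℂ) :
    ∫ x, h x ∂gammaMeasure (n + 1) r = ∫ x in Ioi (0 : ℝ), (erlangDensity n r x : ℂ) * h x := by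
  rw [gammaMeasure, integral_withDensity_eq_integral_toReal_smul
    (by unfold gammaPDF; fun_prop) (Eventually.of_forall fun x => by simp [gammaPDF]),
    ← integral_Ici_eq_integral_Ioi, ← setIntegral_eq_integral_of_forall_compl_eq_zero (s := Ici 0)]
  · refine setIntegral_congr_fun measurableSet_Ici fun x hx => ?_
    rw [mem_Ici] at hx
    rw [gammaPDF, ENNReal.toReal_ofReal (gammaPDFReal_nonneg (by positivity) hr x), gammaPDFReal,
      if_pos hx, Real.Gamma_nat_eq_factorial, add_sub_cancel_right, Real.rpow_natCast,
      erlangDensity, Complex.real_smul]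
    norm_cast
  · intro x hx
    rw [gammaPDF_of_neg (by simpa using hx)]
    simp

lemma integral_expMeasure {r : ℝ} (hr : 0 < r) (h : ℝ → ℂ) :
    ∫ x, h x ∂expMeasure r = ∫ x in Ioi (0 : ℝ), (r * Real.exp (-(r * x)) : ℂ) * h x := by
  have := integral_gammaMeasure 0 hr h
  simp only [Nat.cast_zero, zero_add] at this
  rw [expMeasure, this]
  simp [erlangDensity]

lemma ae_nonneg_expMeasure (r : ℝ) : ∀ᵐ x ∂expMeasure r, 0 ≤ x := by
  rw [ae_iff, show {x : ℝ | ¬0 ≤ x} = Iio 0 by ext; simp, expMeasure, gammaMeasure,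
    withDensity_apply _ measurableSet_Iio]
  exact lintegral_gammaPDF_of_nonpos le_rfl

/-- This is the Laplace integral at the complex rate `r - it`. It identifies the laws of sums of
independent exponential variables. -/
lemma charFun_gammaMeasure (n : ℕ) {r : ℝ} (hr : 0 < r) (t : ℝ) :
    charFun (gammaMeasure (n + 1) r) t = (r / (r - t * Complex.I)) ^ (n + 1) := by
  rw [charFun_apply_real, integral_gammaMeasure n hr, div_pow, div_eq_mul_inv,
    ← integral_pow_mul_exp_neg_Ioi n _ (by simpa using hr), ← integral_const_mul]
  congr 1 with x
  rw [erlangDensity]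
  push_cast
  rw [show -((r - t * Complex.I) * (x : ℂ)) = -(r * x) + t * x * Complex.I by ring, Complex.exp_add]
  ring

lemma charFun_expMeasure {r : ℝ} (hr : 0 < r) (t : ℝ) :
    charFun (expMeasure r) t = r / (r - t * Complex.I) := by
  simpa [expMeasure] using charFun_gammaMeasure 0 hr t

section Laws

variable {Ω : Type*} [MeasurableSpace Ω] {P : Measure Ω} [IsProbabilityMeasure P]

/-- A sum of `n + 1` independent exponential variables has a gamma distribution. -/
lemma map_sum_eq_gammaMeasure {ι : Type*} {X : ι → Ω → ℝ} {r : ℝ} (hr : 0 < r)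
    (hX : ∀ i, Measurable (X i)) (hind : iIndepFun X P) {n : ℕ} {T : Finset ι}
    (hlaw : ∀ i ∈ T, HasLaw (X i) (expMeasure r) P) (hT : T.card = n + 1) :
    P.map (∑ i ∈ T, X i) = gammaMeasure (n + 1) r := by
  have := isProbabilityMeasure_gammaMeasure (a := (n : ℝ) + 1) (by positivity) hr
  have hm : AEMeasurable (∑ i ∈ T, X i) P := by fun_prop
  have := Measure.isProbabilityMeasure_map hm
  refine Measure.ext_of_charFun ?_
  rw [iIndepFun.charFun_map_finsetSum_eq_prod (fun i _ => (hX i).aemeasurable)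
    (hind.restrict T)]
  ext t
  rw [Finset.prod_apply, charFun_gammaMeasure n hr, ← hT, ← Finset.prod_const]
  exact Finset.prod_congr rfl fun i hi => by rw [(hlaw i hi).map_eq, charFun_expMeasure hr]

/-- Tilting by `e^{-vx}` replaces the rate `ξ` by `v + ξ`; truncation then leaves an incomplete
gamma integral up to `V`. -/
lemma integral_indicator_exp_gammaMeasure (n : ℕ) {xi V : ℝ} (hxi : 0 < xi) (hV : 0 ≤ V)
    (v : ℂ) (hv : 0 ≤ v.re) :
    ∫ x, (Iic V).indicator (fun x : ℝ => Complex.exp (-v * x)) x ∂gammaMeasure (n + 1) xi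
      = (xi / (v + xi)) ^ (n + 1) * regGamma ((n + 1 : ℕ) : ℂ) ((v + xi) * V) := by
  rw [integral_gammaMeasure n hxi]
  have hpt : ∀ x : ℝ, (erlangDensity n xi x : ℂ)
      * (Iic V).indicator (fun x : ℝ => Complex.exp (-v * x)) x
      = (Iic V).indicator (fun x : ℝ => (xi : ℂ) ^ (n + 1) * ((x : ℂ) ^ n / (n.factorial : ℂ)
          * Complex.exp (-((v + xi) * x)))) x := fun x => by
    by_cases hx : x ∈ Iic V
    · rw [indicator_of_mem hx, indicator_of_mem hx, erlangDensity]
      push_cast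
      rw [show -((v + xi) * (x : ℂ)) = -(xi * x) + -v * x by ring, Complex.exp_add]
      ring
    · rw [indicator_of_notMem hx, indicator_of_notMem hx, mul_zero]
  simp_rw [hpt]
  rw [setIntegral_indicator measurableSet_Iic, Ioi_inter_Iic, integral_const_mul,
    integral_pow_mul_exp_neg_Ioc n _ (by simpa using by linarith) V hV, regGamma_natCast, div_pow]
  ring

/-- The law of the sum of `m ≥ 1` independent exponential variables, tilted and truncated. -/
lemma integral_indicator_exp_sum {ι : Type*} {X : ι → Ω → ℝ} {xi V : ℝ} (hxi : 0 < xi) (hV : 0 ≤ V)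
    (hX : ∀ i, Measurable (X i)) (hind : iIndepFun X P)
    (hlaw : ∀ i, HasLaw (X i) (expMeasure xi) P) (v : ℂ) (hv : 0 ≤ v.re) {T : Finset ι}
    (hT : T.Nonempty) :
    ∫ ω, (Iic V).indicator (fun x : ℝ => Complex.exp (-v * x)) (∑ i ∈ T, X i ω) ∂P
      = (xi / (v + xi)) ^ T.card * regGamma (T.card : ℂ) ((v + xi) * V) := by
  obtain ⟨n, hn⟩ : ∃ n, T.card = n + 1 := ⟨T.card - 1, by have := hT.card_pos; omega⟩
  rw [hn, ← integral_indicator_exp_gammaMeasure n hxi hV v hv,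
    ← map_sum_eq_gammaMeasure hxi hX hind (fun i _ => hlaw i) hn, integral_map]
  · simp
  · fun_prop
  · exact (Measurable.indicator (by fun_prop) measurableSet_Iic).aestronglyMeasurable

/-- The densities of the points of a renewal process with exponential waiting times add up to
its rate. -/
lemma hasSum_integral_gammaMeasure {r : ℝ} (hr : 0 < r) {h : ℝ → ℂ} (hh : Measurable h)
    (hi : IntegrableOn h (Ioi 0)) :
    HasSum (fun i : ℕ => ∫ x, h x ∂gammaMeasure (i + 1) r) (r * ∫ x in Ioi (0 : ℝ), h x) := by
  -- The exponential series of `rx` cancels the factor `e^{-rx}`.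
  have hsum : ∀ x : ℝ, HasSum (fun i => erlangDensity i r x) r := fun x => by
    have h1 := (NormedSpace.expSeries_div_hasSum_exp (r * x)).mul_left (r * Real.exp (-(r * x)))
    rw [← Real.exp_eq_exp_ℝ, mul_assoc, ← Real.exp_add, neg_add_cancel, Real.exp_zero,
      mul_one] at h1
    convert! h1 using 1
    ext i
    rw [erlangDensity, mul_pow]
    ring
  simp_rw [integral_gammaMeasure _ hr]
  rw [← integral_const_mul]
  refine hasSum_integral_of_dominated_convergence
    (fun i x => erlangDensity i r x * ‖h x‖) (fun i => ?_) (fun i => ?_) ?_ ?_ ?_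
  · have : Measurable fun x => erlangDensity i r x := by unfold erlangDensity; fun_prop
    exact (this.complex_ofReal.mul hh).aestronglyMeasurable
  · filter_upwards [ae_restrict_mem measurableSet_Ioi] with x hx
    rw [mem_Ioi] at hx
    rw [norm_mul, Complex.norm_real, Real.norm_of_nonneg (by unfold erlangDensity; positivity)]
  · exact Eventually.of_forall fun x => ((hsum x).mul_right _).summable
  · simp_rw [fun x => ((hsum x).mul_right ‖h x‖).tsum_eq]
    exact hi.norm.const_mul _
  · exact Eventually.of_forall fun x => (Complex.hasSum_ofReal.2 (hsum x)).mul_right _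

/-! ### Sums of independent geometric variables -/

lemma measureReal_add_eq_of_indepFun {X Y : Ω → ℕ} (hX : Measurable X) (hY : Measurable Y)
    (h : IndepFun X Y P) (k : ℕ) :
    P.real {ω | X ω + Y ω = k}
      = ∑ p ∈ Finset.HasAntidiagonal.antidiagonal k,
          P.real {ω | X ω = p.1} * P.real {ω | Y ω = p.2} := by
  have hU : {ω | X ω + Y ω = k} = ⋃ p ∈ Finset.HasAntidiagonal.antidiagonal k,
      X ⁻¹' {p.1} ∩ Y ⁻¹' {p.2} := by
    ext ω
    simp only [mem_ofPred_eq, mem_iUnion, mem_inter_iff, mem_preimage, mem_singleton_iff,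
      Finset.HasAntidiagonal.mem_antidiagonal, exists_prop]
    exact ⟨fun hk => ⟨(X ω, Y ω), hk, rfl, rfl⟩, fun ⟨p, hp, h1, h2⟩ => by rw [h1, h2, hp]⟩
  rw [hU, measureReal_biUnion_finset]
  · refine Finset.sum_congr rfl fun p _ => ?_
    rw [measureReal_def, h.measure_inter_preimage_eq_mul _ _ (measurableSet_singleton _)
      (measurableSet_singleton _), ENNReal.toReal_mul]
    rfl
  · intro p _ q _ hpq
    refine disjoint_left.2 fun ω hp hq => hpq ?_
    simp only [mem_inter_iff, mem_preimage, mem_singleton_iff] at hp hq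
    exact Prod.ext (hp.1.symm.trans hq.1) (hp.2.symm.trans hq.2)
  · exact fun p _ => (hX (measurableSet_singleton _)).inter (hY (measurableSet_singleton _))

/-- The law is prescribed only on positive integers; those masses already add up to one, so `0` has
none. -/
lemma measureReal_eq_geomWeight {a : ℝ} (ha : 0 < a) (ha' : a ≤ 1) {X : Ω → ℕ} (hX : Measurable X)
    (hlaw : ∀ j, P {ω | X ω = j + 1} = ENNReal.ofReal (a * (1 - a) ^ j)) (j : ℕ) :
    P.real {ω | X ω = j} = geomWeight a j := by
  cases j with
  | succ j =>
    rw [measureReal_def, hlaw, geomWeight, ENNReal.toReal_ofReal]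
    exact mul_nonneg ha.le (pow_nonneg (by linarith) _)
  | zero =>
    have h0 : {ω | X ω = 0} = (⋃ j, X ⁻¹' {j + 1})ᶜ := by
      ext ω
      simp only [mem_ofPred_eq, mem_compl_iff, mem_iUnion, mem_preimage, mem_singleton_iff, not_exists]
      exact ⟨fun h j => by omega, fun h => by_contra fun hc => h (X ω - 1) (by omega)⟩
    have h1 : HasSum (fun j => a * (1 - a) ^ j) 1 := by
      have := (hasSum_geometric_of_lt_one (r := 1 - a) (by linarith) (by linarith)).mul_left a
      rwa [sub_sub_cancel, mul_inv_cancel₀ ha.ne'] at this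
    rw [geomWeight, measureReal_def, h0, (prob_compl_eq_zero_iff (MeasurableSet.iUnion fun j =>
      hX (measurableSet_singleton _))).2, ENNReal.toReal_zero]
    refine (measure_iUnion (f := fun j => {ω | X ω = j + 1}) ?_ ?_).trans ?_
    rotate_right
    · rw [tsum_congr hlaw, ← ENNReal.ofReal_tsum_of_nonneg _ h1.summable, h1.tsum_eq,
        ENNReal.ofReal_one]
      exact fun j => mul_nonneg ha.le (pow_nonneg (by linarith) _)
    · intro i j hij
      refine disjoint_left.2 fun ω hi hj => hij ?_
      simp only [mem_ofPred_eq] at hi hj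
      omega
    · exact fun j => hX (measurableSet_singleton _)

lemma measureReal_sum_eq_negBin {a : ℝ} {n : ℕ → Ω → ℕ} (hn : ∀ k, Measurable (n k))
    (hind : iIndepFun n P) (hlaw : ∀ k j, P.real {ω | n k ω = j} = geomWeight a j)
    (S : Finset ℕ) (j : ℕ) :
    P.real {ω | ∑ k ∈ S, n k ω = j} = negBin a S.card j := by
  induction S using Finset.induction_on generalizing j with
  | empty => cases j <;> simp [negBin]
  | insert i S hi ih =>
    have h := (hind.indepFun_finsetSum_of_notMem hn hi).symm
    have hS : Measurable (∑ k ∈ S, n k) := by fun_prop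
    have := measureReal_add_eq_of_indepFun (hn i) hS h j
    simp only [Finset.sum_apply] at this
    simp_rw [Finset.sum_insert hi]
    rw [this, Finset.card_insert_of_notMem hi, negBin_succ_eq_sum]
    exact Finset.sum_congr rfl fun p _ => by rw [hlaw, ih]

lemma measureReal_sum_inter_sum {a : ℝ} {n : ℕ → Ω → ℕ} (hn : ∀ k, Measurable (n k))
    (hind : iIndepFun n P) (hlaw : ∀ k j, P.real {ω | n k ω = j} = geomWeight a j)
    {S T : Finset ℕ} (hST : Disjoint S T) (i j : ℕ) :
    P.real {ω | ∑ k ∈ S, n k ω = i ∧ ∑ k ∈ T, n k ω = j}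
      = negBin a S.card i * negBin a T.card j := by
  have h := hind.indepFun_finset S T hST hn
  have h' : IndepFun (fun ω => ∑ k ∈ S, n k ω) (fun ω => ∑ k ∈ T, n k ω) P := by
    have := h.comp (φ := fun x : S → ℕ => ∑ k, x k) (ψ := fun x : T → ℕ => ∑ k, x k)
      (by fun_prop) (by fun_prop)
    convert this using 1 <;> ext ω
    · exact (Finset.sum_coe_sort S fun k => n k ω).symm
    · exact (Finset.sum_coe_sort T fun k => n k ω).symm
  rw [← measureReal_sum_eq_negBin hn hind hlaw S, ← measureReal_sum_eq_negBin hn hind hlaw T,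
    measureReal_def, measureReal_def, measureReal_def, ← ENNReal.toReal_mul]
  exact congrArg _ (h'.measure_inter_preimage_eq_mul {i} {j} (measurableSet_singleton _)
    (measurableSet_singleton _))

/-- Fubini's theorem for independent random elements. -/
lemma integral_indepFun {α β : Type*} [MeasurableSpace α] [MeasurableSpace β]
    {X : Ω → α} {Y : Ω → β} (hX : Measurable X) (hY : Measurable Y) (h : IndepFun X Y P)
    {Φ : α × β → ℂ} (hΦ : Measurable Φ) (hint : Integrable (fun ω => Φ (X ω, Y ω)) P) :
    ∫ ω, Φ (X ω, Y ω) ∂P = ∫ ω, ∫ ω', Φ (X ω', Y ω) ∂P ∂P := by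
  have := Measure.isProbabilityMeasure_map (μ := P) hX.aemeasurable
  have := Measure.isProbabilityMeasure_map (μ := P) hY.aemeasurable
  have hXY : Measurable fun ω => (X ω, Y ω) := hX.prodMk hY
  have hmap := (indepFun_iff_map_prod_eq_prod_map_map hX.aemeasurable hY.aemeasurable).1 h
  have hi : Integrable Φ (P.map fun ω => (X ω, Y ω)) :=
    (integrable_map_measure hΦ.aestronglyMeasurable hXY.aemeasurable).2 hint
  rw [hmap] at hi
  rw [← integral_map (f := Φ) hXY.aemeasurable hΦ.aestronglyMeasurable, hmap,
    integral_prod_symm _ hi, integral_map hY.aemeasurable]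
  · refine integral_congr_ae (Eventually.of_forall fun ω => ?_)
    exact integral_map hX.aemeasurable
      (hΦ.comp (measurable_id.prodMk measurable_const)).aestronglyMeasurable
  · exact (StronglyMeasurable.integral_prod_right (f := fun y x => Φ (x, y))
      (hΦ.comp measurable_swap).stronglyMeasurable).aestronglyMeasurable

end Laws

/-! ### Finite sets of indices -/

open Classical in
/-- A finite set of natural numbers as a `Finset`; infinite sets are sent to `∅`. -/
noncomputable def finitePart (T : Set ℕ) : Finset ℕ := if h : T.Finite then h.toFinset else ∅

lemma mem_finitePart {T : Set ℕ} {k : ℕ} : k ∈ finitePart T ↔ T.Finite ∧ k ∈ T := by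
  unfold finitePart
  split_ifs with h <;> simp [h]

/-- The default `∅` for infinite sets matches the convention that `ncard` is `0` there. -/
lemma card_finitePart (T : Set ℕ) : (finitePart T).card = T.ncard := by
  unfold finitePart
  split_ifs with h
  · exact (ncard_eq_toFinset_card T h).symm
  · rw [Set.Infinite.ncard h, Finset.card_empty]

/-- Random index sets become random elements of the countable space `Finset ℕ`, so that later
measurability proofs can fix the set. -/
lemma measurable_finitePart : Measurable finitePart := by
  refine measurable_finset_iff.2 fun k => ?_
  simp only [mem_finitePart]
  exact (measurableSet_setOfPred.1 MeasurableSet.setOfPred_finite).and (measurable_set_mem k)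

/-- The indices of the points of the sequence `x` that lie in `S`. -/
noncomputable def indicesIn (x : ℕ → ℝ) (S : Set ℝ) : Finset ℕ := finitePart {k | x k ∈ S}

lemma mem_indicesIn {x : ℕ → ℝ} {S : Set ℝ} (h : {k | x k ∈ S}.Finite) {k : ℕ} :
    k ∈ indicesIn x S ↔ x k ∈ S := by
  rw [indicesIn, mem_finitePart]
  exact ⟨fun h' => h'.2, fun h' => ⟨h, h'⟩⟩

lemma disjoint_indicesIn (x : ℕ → ℝ) {S T : Set ℝ} (h : Disjoint S T) :
    Disjoint (indicesIn x S) (indicesIn x T) := by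
  refine Finset.disjoint_left.2 fun k hS hT => ?_
  rw [indicesIn, mem_finitePart] at hS hT
  exact disjoint_left.1 h hS.2 hT.2

lemma pointCount_eq_card {Ω : Type*} (t : ℕ → Ω → ℝ) (S : Set ℝ) (ω : Ω) :
    pointCount t S ω = (indicesIn (fun k => t k ω) S).card := (card_finitePart _).symm

lemma measurable_indicesIn {α : Type*} [MeasurableSpace α] {x : α → ℕ → ℝ} {S : α → Set ℝ}
    (h : ∀ k, MeasurableSet {p | x p k ∈ S p}) : Measurable fun p => indicesIn (x p) (S p) :=
  measurable_finitePart.comp (measurable_set_iff.2 fun k => measurableSet_setOfPred.1 (h k))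

lemma tsum_indicator_eq_sum_indicesIn {α : Type*} [AddCommMonoid α] [TopologicalSpace α]
    {x : ℕ → ℝ} {S : Set ℝ} (h : {k | x k ∈ S}.Finite) (y : ℕ → α) :
    ∑' k, S.indicator (fun _ => y k) (x k) = ∑ k ∈ indicesIn x S, y k := by
  rw [tsum_eq_sum (s := indicesIn x S)]
  · exact Finset.sum_congr rfl fun k hk => indicator_of_mem ((mem_indicesIn h).1 hk) _
  · exact fun k hk => indicator_of_notMem (fun h' => hk ((mem_indicesIn h).2 h')) _

/-! ### Regular sample points -/

section Paths

variable {Ω : Type*}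

/-- The sample points at which all sums in the model are finite, all losses are nonnegative and
there is no initial loss. -/
structure IsRegular (t : ℕ → Ω → ℝ) (w : ℕ → ℕ → Ω → ℝ) (D : ℕ → Ω → ℝ) (ω : Ω) : Prop where
  obs_zero : D 0 ω = 0
  obs_nonneg : ∀ i, 0 ≤ D i ω
  finite : ∀ s, {k | t k ω ∈ Icc 0 s}.Finite
  ne_zero : ∀ k, t k ω ≠ 0
  weights_nonneg : ∀ k j, 0 ≤ w k j ω

variable {t : ℕ → Ω → ℝ} {n : ℕ → Ω → ℕ} {w : ℕ → ℕ → Ω → ℝ} {D : ℕ → Ω → ℝ} {ω : Ω}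

lemma obsTime_succ (D : ℕ → Ω → ℝ) (i : ℕ) (ω : Ω) :
    obsTime D (i + 1) ω = obsTime D i ω + D (i + 1) ω := Finset.sum_range_succ _ _

lemma IsRegular.obsTime_zero (h : IsRegular t w D ω) : obsTime D 0 ω = 0 := by
  simp [obsTime, h.obs_zero]

lemma IsRegular.obsTime_nonneg (h : IsRegular t w D ω) (i : ℕ) : 0 ≤ obsTime D i ω :=
  Finset.sum_nonneg fun _ _ => h.obs_nonneg _

lemma IsRegular.obsTime_le_succ (h : IsRegular t w D ω) (i : ℕ) :
    obsTime D i ω ≤ obsTime D (i + 1) ω := by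
  rw [obsTime_succ]
  linarith [h.obs_nonneg (i + 1)]

lemma IsRegular.finite_Ioc (h : IsRegular t w D ω) {r : ℝ} (hr : 0 ≤ r) (s : ℝ) :
    {k | t k ω ∈ Ioc r s}.Finite :=
  (h.finite s).subset fun _ hk => ⟨hr.trans hk.1.le, hk.2⟩

lemma IsRegular.indicesIn_Icc_union (h : IsRegular t w D ω) (i : ℕ) :
    indicesIn (fun k => t k ω) (Icc 0 (obsTime D (i + 1) ω))
      = indicesIn (fun k => t k ω) (Icc 0 (obsTime D i ω))
        ∪ indicesIn (fun k => t k ω) (Ioc (obsTime D i ω) (obsTime D (i + 1) ω)) := by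
  ext k
  rw [Finset.mem_union, mem_indicesIn (h.finite _), mem_indicesIn (h.finite _),
    mem_indicesIn (h.finite_Ioc (h.obsTime_nonneg i) _),
    ← Icc_union_Ioc_eq_Icc (h.obsTime_nonneg i) (h.obsTime_le_succ i), mem_union]

lemma disjoint_Icc_Ioc (a b c : ℝ) : Disjoint (Icc a b) (Ioc b c) :=
  disjoint_left.2 fun _ hx hy => hy.1.not_ge hx.2

/-- The increments over the windows up to the `i`-th add up to the sum over the attacks up to the
time of the `i`-th observation. -/
lemma IsRegular.sum_tsum_window (h : IsRegular t w D ω) {α : Type*} [AddCommMonoid α]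
    [TopologicalSpace α] (y : ℕ → α) (i : ℕ) :
    ∑ j ∈ Finset.range (i + 1), ∑' k, (window D j ω).indicator (fun _ => y k) (t k ω)
      = ∑ k ∈ indicesIn (fun k => t k ω) (Icc 0 (obsTime D i ω)), y k := by
  induction i with
  | zero =>
    rw [Finset.sum_range_one]
    exact tsum_indicator_eq_sum_indicesIn (h.finite _) y
  | succ i ih =>
    rw [Finset.sum_range_succ, ih, h.indicesIn_Icc_union,
      Finset.sum_union (disjoint_indicesIn _ (disjoint_Icc_Ioc _ _ _))]
    congr 1
    exact tsum_indicator_eq_sum_indicesIn (h.finite_Ioc (h.obsTime_nonneg i) _) y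

lemma IsRegular.nodeLoss_eq (h : IsRegular t w D ω) (i : ℕ) :
    nodeLoss t n D i ω = ∑ k ∈ indicesIn (fun k => t k ω) (Icc 0 (obsTime D i ω)), n k ω :=
  h.sum_tsum_window _ i

lemma IsRegular.weightLoss_eq (h : IsRegular t w D ω) (i : ℕ) :
    weightLoss t n w D i ω = ∑ k ∈ indicesIn (fun k => t k ω) (Icc 0 (obsTime D i ω)),
      ∑ j ∈ Finset.range (n k ω), w k j ω :=
  h.sum_tsum_window _ i

lemma IsRegular.nodeLoss_zero (h : IsRegular t w D ω) : nodeLoss t n D 0 ω = 0 := by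
  rw [h.nodeLoss_eq, h.obsTime_zero]
  refine Finset.sum_eq_zero fun k hk => absurd ?_ (h.ne_zero k)
  simpa using (mem_indicesIn (h.finite 0)).1 hk

lemma IsRegular.nodeLoss_mono (_h : IsRegular t w D ω) : Monotone fun i => nodeLoss t n D i ω :=
  monotone_nat_of_le_succ fun i => by
    unfold nodeLoss
    rw [Finset.sum_range_succ _ (i + 1)]
    exact Nat.le_add_right _ _

lemma IsRegular.weightLoss_mono (h : IsRegular t w D ω) :
    Monotone fun i => weightLoss t n w D i ω :=
  monotone_nat_of_le_succ fun i => by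
    unfold weightLoss
    rw [Finset.sum_range_succ _ (i + 1)]
    refine le_add_of_nonneg_right (tsum_nonneg fun k => indicator_nonneg (fun _ _ => ?_) _)
    exact Finset.sum_nonneg fun j _ => h.weights_nonneg k j

lemma IsRegular.weightLoss_nonneg (h : IsRegular t w D ω) (i : ℕ) :
    0 ≤ weightLoss t n w D i ω := by
  rw [h.weightLoss_eq]
  exact Finset.sum_nonneg fun k _ => Finset.sum_nonneg fun j _ => h.weights_nonneg k j

end Paths

/-! ### Exit indices -/

lemma exitIndex_le_iff {α : Type*} [LT α] (x : ℕ → α) (L : α) (i : ℕ) :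
    exitIndex x L ≤ i ↔ ∃ j ≤ i, L < x j := by
  constructor
  · intro h
    have hne : ((fun i : ℕ => (i : ℕ∞)) '' {i | L < x i}).Nonempty := by
      by_contra hc
      rw [not_nonempty_iff_eq_empty] at hc
      rw [exitIndex, hc, sInf_empty] at h
      exact absurd h (by simp)
    obtain ⟨j, hj, hj'⟩ := csInf_mem hne
    refine ⟨j, ?_, hj⟩
    have : (j : ℕ∞) ≤ i := hj'.trans_le h
    exact_mod_cast this
  · rintro ⟨j, hji, hj⟩
    exact le_trans (sInf_le (mem_image_of_mem _ hj)) (Nat.cast_le.2 hji)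

lemma lt_exitIndex_iff {α : Type*} [LinearOrder α] (x : ℕ → α) (L : α) (i : ℕ) :
    (i : ℕ∞) < exitIndex x L ↔ ∀ j ≤ i, x j ≤ L := by
  rw [← not_le, exitIndex_le_iff]
  push Not
  rfl

lemma exitIndex_eq_coe {α : Type*} [LinearOrder α] {x : ℕ → α} {L : α} {i : ℕ} (hi : L < x i)
    (h : ∀ j < i, x j ≤ L) : exitIndex x L = i := by
  refine le_antisymm ((exitIndex_le_iff x L i).2 ⟨i, le_rfl, hi⟩) ?_
  cases i with
  | zero => simp
  | succ i =>
    have := (lt_exitIndex_iff x L i).2 fun j hj => h j (Nat.lt_succ_of_le hj)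
    simpa using Order.add_one_le_of_lt this

/-- Valid for integer values only; `1 ≤ L` keeps the truncated subtraction honest. -/
lemma reachIndex_eq_exitIndex (x : ℕ → ℕ) {L : ℕ} (hL : 1 ≤ L) :
    reachIndex x L = exitIndex x (L - 1) := by
  rw [reachIndex, exitIndex]
  congr 2
  ext i
  simp only [mem_ofPred_eq]
  omega

lemma reachExit_eq_strictExit {Ω : Type*} (t : ℕ → Ω → ℝ) (n : ℕ → Ω → ℕ)
    (w : ℕ → ℕ → Ω → ℝ) (D : ℕ → Ω → ℝ) {M₁ M : ℕ} (h : 1 ≤ M₁) (h' : 1 ≤ M) (V : ℝ) (u v θ : ℂ) :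
    reachExit t n w D M₁ M V u v θ = strictExit t n w D (M₁ - 1) (M - 1) V u v θ := by
  unfold reachExit strictExit
  simp_rw [reachIndex_eq_exitIndex _ h, reachIndex_eq_exitIndex _ h']

open Classical in
/-- A functional at the exit index is the sum over all possible values of the index. -/
lemma hasSum_exitIndex {E : Type*} [AddCommMonoid E] [TopologicalSpace E] {N : ℕ → ℕ} {W : ℕ → ℝ}
    (hN : Monotone N) (hW : Monotone W) (L M : ℕ) (V : ℝ) (c : ℕ → E) :
    HasSum (fun i => if (∀ j < i, N j ≤ L) ∧ L < N i ∧ N i ≤ M ∧ W i ≤ V then c i else 0)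
      (if exitIndex N L < min (exitIndex N M) (exitIndex W V) then c (exitIndex N L).toNat
        else 0) := by
  by_cases h : ∃ i, L < N i
  · have hi := Nat.find_spec h
    have hlt : ∀ j < Nat.find h, N j ≤ L := fun j hj => not_lt.1 (Nat.find_min h hj)
    set i := Nat.find h
    have he : exitIndex N L = i := exitIndex_eq_coe hi hlt
    -- By monotonicity, the bounds `M` and `V` hold at all indices up to `i` once they hold at `i`.
    have hiff : exitIndex N L < min (exitIndex N M) (exitIndex W V)
        ↔ (∀ j < i, N j ≤ L) ∧ L < N i ∧ N i ≤ M ∧ W i ≤ V := by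
      rw [he, lt_min_iff, lt_exitIndex_iff, lt_exitIndex_iff]
      exact ⟨fun h => ⟨hlt, hi, h.1 i le_rfl, h.2 i le_rfl⟩,
        fun h => ⟨fun j hj => (hN hj).trans h.2.2.1, fun j hj => (hW hj).trans h.2.2.2⟩⟩
    simp only [hiff]
    rw [he, ENat.toNat_natCast]
    refine hasSum_single i fun j hj => if_neg fun hc => ?_
    rcases lt_or_gt_of_ne hj with hj | hj
    · exact (hlt j hj).not_gt hc.2.1
    · exact (hc.1 i hj).not_gt hi
  · push Not at h
    have he : ¬ exitIndex N L < min (exitIndex N M) (exitIndex W V) := by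
      have : exitIndex N L = ⊤ := by
        rw [exitIndex, eq_empty_of_forall_notMem (s := {i | L < N i}) fun i => (h i).not_gt,
          image_empty, sInf_empty]
      rw [this]
      exact not_top_lt
    rw [if_neg he]
    convert! hasSum_zero with i
    exact if_neg fun hc => (h i).not_gt hc.2.1

/-! ### Independence -/

section Independence

variable {Ω : Type*} [MeasurableSpace Ω] {P : Measure Ω} [IsProbabilityMeasure P]
  {α β γ : Type*} [MeasurableSpace α] [MeasurableSpace β] [MeasurableSpace γ]

/-- The hypotheses are the nested form of mutual independence of three elements. The conclusion
regroups them and is checked on measurable boxes. -/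
lemma indepFun_prodMk_of_indepFun {X : Ω → α} {Y : Ω → β} {Z : Ω → γ} (hX : Measurable X)
    (hY : Measurable Y) (hZ : Measurable Z) (h : IndepFun X (fun ω => (Y ω, Z ω)) P)
    (h' : IndepFun Y Z P) : IndepFun Y (fun ω => (X ω, Z ω)) P := by
  have := Measure.isProbabilityMeasure_map (μ := P) hX.aemeasurable
  have := Measure.isProbabilityMeasure_map (μ := P) hY.aemeasurable
  have := Measure.isProbabilityMeasure_map (μ := P) hZ.aemeasurable
  have hXZ : IndepFun X Z P := h.comp measurable_id measurable_snd
  rw [indepFun_iff_map_prod_eq_prod_map_map hY.aemeasurable (hX.prodMk hZ).aemeasurable,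
    (indepFun_iff_map_prod_eq_prod_map_map hX.aemeasurable hZ.aemeasurable).1 hXZ]
  refine Measure.ext_prod₃ fun {s t u} hs ht hu => ?_
  rw [Measure.map_apply (by fun_prop) (hs.prod (ht.prod hu)), Measure.prod_prod,
    Measure.prod_prod, Measure.map_apply hX ht, Measure.map_apply hY hs, Measure.map_apply hZ hu]
  have h1 := h.measure_inter_preimage_eq_mul t (s ×ˢ u) ht (hs.prod hu)
  have h2 := h'.measure_inter_preimage_eq_mul s u hs hu
  have e1 : (fun ω => (Y ω, X ω, Z ω)) ⁻¹' s ×ˢ t ×ˢ u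
      = X ⁻¹' t ∩ (fun ω => (Y ω, Z ω)) ⁻¹' s ×ˢ u := by
    ext ω; simp only [mem_preimage, mem_prod, mem_inter_iff]; tauto
  have e2 : (fun ω => (Y ω, Z ω)) ⁻¹' s ×ˢ u = Y ⁻¹' s ∩ Z ⁻¹' u := by
    ext ω; simp
  rw [e1, h1, e2, h2]
  ring

end Independence

/-! ### The contribution of one observation -/

/-- The weight `u^{x+y}` of a loss of `y` nodes after `x` nodes which leads from below the level `L`
to a level in `(L, M]`. -/
def nodeFactor (L M : ℕ) (u : ℂ) (x y : ℕ) : ℂ :=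
  if x ≤ L ∧ L < x + y ∧ x + y ≤ M then u ^ (x + y) else 0

/-- `e^{-vx} 1{x ≤ V}`. -/
noncomputable def weightFactor (V : ℝ) (v : ℂ) (x : ℝ) : ℂ :=
  (Iic V).indicator (fun x : ℝ => Complex.exp (-v * x)) x

/-- The expectation of `weightFactor` at the total weight of `m` nodes. -/
noncomputable def weightTransform (xi V : ℝ) (v : ℂ) (m : ℕ) : ℂ :=
  (xi / (v + xi)) ^ m * regGamma m ((v + xi) * V)

/-- The weight of a path of node numbers and node weights if the attacks with indices in the first
set take place up to the last but one observation, and those in the second set after it. -/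
noncomputable def lossFactor (L M : ℕ) (V : ℝ) (u v : ℂ)
    (p : ((ℕ → ℕ) × (ℕ → ℕ → ℝ)) × (Finset ℕ × Finset ℕ)) : ℂ :=
  nodeFactor L M u (∑ k ∈ p.2.1, p.1.1 k) (∑ k ∈ p.2.2, p.1.1 k)
    * weightFactor V v (∑ k ∈ p.2.1 ∪ p.2.2, ∑ j ∈ Finset.range (p.1.1 k), p.1.2 k j)

lemma measurable_weightFactor (V : ℝ) (v : ℂ) : Measurable (weightFactor V v) :=
  Measurable.indicator (by fun_prop) measurableSet_Iic

lemma norm_exp_neg_mul_le_one {v : ℂ} (hv : 0 ≤ v.re) {x : ℝ} (hx : 0 ≤ x) :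
    ‖Complex.exp (-v * x)‖ ≤ 1 := by
  rw [Complex.norm_exp, Real.exp_le_one_iff]
  simpa using mul_nonneg hv hx

lemma norm_weightFactor_le_one (V : ℝ) {v : ℂ} (hv : 0 ≤ v.re) {x : ℝ} (hx : 0 ≤ x) :
    ‖weightFactor V v x‖ ≤ 1 := by
  unfold weightFactor
  rw [indicator_apply]
  split_ifs
  · exact norm_exp_neg_mul_le_one hv hx
  · simp

lemma norm_nodeFactor_le_one (L M : ℕ) {u : ℂ} (hu : ‖u‖ ≤ 1) (x y : ℕ) :
    ‖nodeFactor L M u x y‖ ≤ 1 := by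
  unfold nodeFactor
  split_ifs
  · rw [norm_pow]
    exact pow_le_one₀ (norm_nonneg _) hu
  · simp

lemma norm_lossFactor_le_one (L M : ℕ) (V : ℝ) {u v : ℂ} (hu : ‖u‖ ≤ 1) (hv : 0 ≤ v.re)
    (p : ((ℕ → ℕ) × (ℕ → ℕ → ℝ)) × (Finset ℕ × Finset ℕ)) (hp : ∀ k j, 0 ≤ p.1.2 k j) :
    ‖lossFactor L M V u v p‖ ≤ 1 := by
  rw [lossFactor, norm_mul]
  exact mul_le_one₀ (norm_nodeFactor_le_one L M hu _ _) (norm_nonneg _)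
    (norm_weightFactor_le_one V hv
      (Finset.sum_nonneg fun k _ => Finset.sum_nonneg fun j _ => hp k j))

lemma measurable_sum_range {α : Type*} [MeasurableSpace α] {f : α → ℕ} {g : ℕ → α → ℝ}
    (hf : Measurable f) (hg : ∀ j, Measurable (g j)) :
    Measurable fun x => ∑ j ∈ Finset.range (f x), g j x := by
  have : Measurable fun p : ℕ × α => ∑ j ∈ Finset.range p.1, g j p.2 :=
    measurable_from_prod_countable_right fun m => by
      simp only
      fun_prop
  exact this.comp (hf.prodMk measurable_id)

lemma measurable_lossFactor (L M : ℕ) (V : ℝ) (u v : ℂ) : Measurable (lossFactor L M V u v) := by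
  refine measurable_from_prod_countable_left fun q => ?_
  simp only [lossFactor]
  refine Measurable.mul ?_ ((measurable_weightFactor V v).comp ?_)
  · have : Measurable fun z : ℕ × ℕ => nodeFactor L M u z.1 z.2 := measurable_of_countable _
    exact this.comp (f := fun x : (ℕ → ℕ) × (ℕ → ℕ → ℝ) =>
      (∑ k ∈ q.1, x.1 k, ∑ k ∈ q.2, x.1 k)) (by fun_prop)
  · exact Finset.measurable_sum _ fun k _ => measurable_sum_range (by fun_prop) (by fun_prop)

section Model

variable {Ω : Type*} [MeasurableSpace Ω] {P : Measure Ω}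
  {lam mu a xi : ℝ} {t : ℕ → Ω → ℝ} {n : ℕ → Ω → ℕ} {w : ℕ → ℕ → Ω → ℝ} {D : ℕ → Ω → ℝ}

lemma IsModelTwo.ae_isRegular (h : IsModelTwo P lam mu a xi t n w D) :
    ∀ᵐ ω ∂P, IsRegular t w D ω := by
  have h1 : ∀ᵐ ω ∂P, ∀ i, 0 ≤ D i ω := ae_all_iff.2 fun i => by
    cases i with
    | zero => exact h.obs_zero.mono fun ω hω => hω.ge
    | succ i => exact ((h.obs_law i).ae_iff (p := fun x => 0 ≤ x)
        (measurableSet_setOfPred.1 measurableSet_Ici)).2 (ae_nonneg_expMeasure mu)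
  have h2 : ∀ᵐ ω ∂P, ∀ m : ℕ, {k | t k ω ∈ Icc 0 (m : ℝ)}.Finite := ae_all_iff.2 fun m =>
    h.attacks.locallyFinite _ measurableSet_Icc Icc_subset_Ici_self (by simp)
  have h3 : ∀ᵐ ω ∂P, ∀ k j, 0 ≤ w k j ω := ae_all_iff.2 fun k => ae_all_iff.2 fun j =>
    ((h.weights_law k j).ae_iff (p := fun x => 0 ≤ x)
      (measurableSet_setOfPred.1 measurableSet_Ici)).2 (ae_nonneg_expMeasure xi)
  -- The set `{0}` has length zero, so its count is Poisson with parameter `0`.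
  have h4 : ∀ᵐ ω ∂P, pointCount t {0} ω = 0 := by
    have hl := h.attacks.count_law {0} (measurableSet_singleton _) (by simp) (by simp)
    refine (hl.ae_iff (p := fun x => x = 0) (measurable_of_countable _)).2 ?_
    rw [ae_iff]
    exact (prob_compl_eq_zero_iff (measurableSet_singleton 0)).2
      (by simp [poissonMeasure_singleton])
  filter_upwards [h1, h2, h3, h4, h.obs_zero] with ω h1 h2 h3 h4 h5
  refine ⟨h5, h1, fun s => ?_, fun k hk => ?_, h3⟩
  · obtain ⟨m, hm⟩ := exists_nat_ge s
    exact (h2 m).subset fun k hk => ⟨hk.1, hk.2.trans hm⟩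
  -- Finiteness is needed because `ncard` also vanishes on infinite sets.
  · have hf : {k | t k ω ∈ ({0} : Set ℝ)}.Finite :=
      (h2 0).subset fun k hk => by simpa using hk
    rw [pointCount, ncard_eq_zero hf] at h4
    exact notMem_empty k (h4 ▸ hk)

variable [IsProbabilityMeasure P]

/-- Given the attacks in the two time intervals, the expectation of the weight of the losses. -/
lemma IsModelTwo.integral_lossFactor (h : IsModelTwo P lam mu a xi t n w D) (ha : 0 < a)
    (ha' : a ≤ 1) (hxi : 0 < xi) {V : ℝ} (hV : 0 ≤ V) (L M : ℕ) {u v : ℂ} (hu : ‖u‖ ≤ 1)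
    (hv : 0 ≤ v.re) {A B : Finset ℕ} (hAB : Disjoint A B) :
    ∫ ω, lossFactor L M V u v ((fun k => n k ω, fun k j => w k j ω), (A, B)) ∂P
      = ∑ m ∈ Finset.Ioc L M, ∑ k ∈ Finset.range (L + 1), u ^ m * weightTransform xi V v m
          * (negBin a A.card k * negBin a B.card (m - k)) := by
  have hind : IndepFun (fun ω k j => w k j ω) (fun ω k => n k ω) P :=
    (h.indep_nodes.comp measurable_id measurable_fst).symm
  have hw := h.weights_measurable
  have hn := h.nodes_measurable
  have hreg := h.ae_isRegular
  set X : Ω → ℕ := fun ω => ∑ k ∈ A, n k ω with hX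
  set Y : Ω → ℕ := fun ω => ∑ k ∈ B, n k ω with hY
  have hΦ : Measurable fun p : (ℕ → ℕ → ℝ) × (ℕ → ℕ) =>
      lossFactor L M V u v ((p.2, p.1), (A, B)) :=
    (measurable_lossFactor L M V u v).comp (by fun_prop)
  have hfub := integral_indepFun (by fun_prop) (by fun_prop) hind hΦ
    (Integrable.of_bound ((hΦ.comp (g := fun p : (ℕ → ℕ → ℝ) × (ℕ → ℕ) =>
      lossFactor L M V u v ((p.2, p.1), (A, B)))
      (f := fun ω => (fun k j => w k j ω, fun k => n k ω))
      (by fun_prop)).aestronglyMeasurable) 1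
      (hreg.mono fun ω hω => norm_lossFactor_le_one L M V hu hv _ hω.weights_nonneg))
  rw [hfub]
  have hinner : ∀ ω, ∫ ω', lossFactor L M V u v ((fun k => n k ω, fun k j => w k j ω'), (A, B)) ∂P
      = nodeFactor L M u (X ω) (Y ω) * weightTransform xi V v (X ω + Y ω) := fun ω => by
    simp only [lossFactor]
    rw [integral_const_mul]
    -- A nonzero factor forces `X + Y > L ≥ 0`, so at least one node is lost and the total weight
    -- has a gamma law.
    by_cases h0 : nodeFactor L M u (X ω) (Y ω) = 0
    · rw [h0, zero_mul, zero_mul]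
    congr 1
    set T : Finset (Σ _ : ℕ, ℕ) := (A ∪ B).sigma fun k => Finset.range (n k ω) with hT
    have hcard : T.card = X ω + Y ω := by
      rw [hT, Finset.card_sigma, Finset.sum_union hAB]
      simp [hX, hY]
    have hne : T.Nonempty := by
      rw [← Finset.card_pos, hcard]
      by_contra hc
      exact h0 (if_neg fun h' => by omega)
    have hwi : iIndepFun (fun p : Σ _ : ℕ, ℕ => w p.1 p.2) P :=
      h.weights_indep.precomp (g := fun p : Σ _ : ℕ, ℕ => (p.1, p.2))
        fun p q hpq => by
          obtain ⟨p1, p2⟩ := p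
          obtain ⟨q1, q2⟩ := q
          simp only [Prod.mk.injEq] at hpq
          rw [hpq.1, hpq.2]
    have key := integral_indicator_exp_sum (X := fun p : Σ _ : ℕ, ℕ => w p.1 p.2) hxi hV
      (fun p => hw _ _) hwi (fun p => h.weights_law _ _) v hv hne
    rw [hcard] at key
    rw [weightTransform, ← key]
    refine integral_congr_ae (Eventually.of_forall fun ω' => ?_)
    simp only [weightFactor, hT, Finset.sum_sigma]
  simp_rw [hinner]
  -- Decomposition by the total `m` and the number `k` lost before the last window. Since `k ≤ L <
  -- m`, the subtraction `m - k` is not truncated.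
  have hpt : ∀ ω, nodeFactor L M u (X ω) (Y ω) * weightTransform xi V v (X ω + Y ω)
      = ∑ m ∈ Finset.Ioc L M, ∑ k ∈ Finset.range (L + 1),
        {ω | X ω = k ∧ Y ω = m - k}.indicator
          (fun _ => u ^ m * weightTransform xi V v m) ω := fun ω => by
    by_cases hc : X ω ≤ L ∧ L < X ω + Y ω ∧ X ω + Y ω ≤ M
    · rw [nodeFactor, if_pos hc, Finset.sum_eq_single (X ω + Y ω), Finset.sum_eq_single (X ω),
        indicator_of_mem]
      · exact ⟨rfl, (Nat.add_sub_cancel_left ..).symm⟩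
      · intro k _ hk
        exact indicator_of_notMem (fun h' => hk h'.1.symm) _
      · intro hk
        exact absurd (Finset.mem_range.2 (Nat.lt_succ_of_le hc.1)) hk
      · intro m hm hne
        refine Finset.sum_eq_zero fun k hk => indicator_of_notMem (fun h' => hne ?_) _
        rw [Finset.mem_Ioc] at hm
        rw [Finset.mem_range] at hk
        have := h'.1
        have := h'.2
        omega
      · intro hm
        exact absurd (Finset.mem_Ioc.2 hc.2) hm
    · rw [nodeFactor, if_neg hc, zero_mul]
      refine (Finset.sum_eq_zero fun m hm => Finset.sum_eq_zero fun k hk =>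
        indicator_of_notMem (fun h' => hc ?_) _).symm
      rw [Finset.mem_Ioc] at hm
      rw [Finset.mem_range] at hk
      have := h'.1
      have := h'.2
      omega
  have hXm : Measurable X := by fun_prop
  have hYm : Measurable Y := by fun_prop
  have hset : ∀ i j, MeasurableSet {ω | X ω = i ∧ Y ω = j} := fun i j =>
    (hXm (measurableSet_singleton i)).inter (hYm (measurableSet_singleton j))
  simp_rw [hpt]
  rw [integral_finsetSum]
  · refine Finset.sum_congr rfl fun m _ => ?_
    rw [integral_finsetSum]
    · refine Finset.sum_congr rfl fun k _ => ?_
      rw [integral_indicator_const _ (hset _ _), measureReal_sum_inter_sum hn h.nodes_indep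
        (fun k => measureReal_eq_geomWeight ha ha' (hn k) (h.nodes_law k)) hAB, Complex.real_smul]
      push_cast
      ring
    · exact fun k _ => (integrable_const _).indicator (hset _ _)
  · exact fun m _ => integrable_finsetSum _ fun k _ => (integrable_const _).indicator (hset _ _)

end Model

/-! ### Averaging over the attack times and the observation times -/

/-- The probability that `k` nodes are lost in a time interval of length `s`. -/
noncomputable def nodeProb (lam a s : ℝ) (k : ℕ) : ℝ :=
  ∑ c ∈ Finset.range (k + 1),
    Real.exp (-(lam * s)) * (lam * s) ^ c / c.factorial * negBin a c k

/-- `e^{-θs}` times the probability that `k` nodes are lost in a time interval of length `s`. -/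
noncomputable def nodeKernel (lam a : ℝ) (θ : ℂ) (k : ℕ) (s : ℝ) : ℂ :=
  Complex.exp (-θ * s) * nodeProb lam a s k

lemma continuous_nodeKernel (lam a : ℝ) (θ : ℂ) (k : ℕ) : Continuous (nodeKernel lam a θ k) := by
  unfold nodeKernel nodeProb
  fun_prop

lemma nodeKernel_zero (lam a : ℝ) (θ : ℂ) (k : ℕ) :
    nodeKernel lam a θ k 0 = if k = 0 then 1 else 0 := by
  rw [nodeKernel, nodeProb, Finset.sum_range_succ']
  cases k <;> simp [negBin]

/-- Every attack destroys at least one node, so only `c ≤ k` attacks contribute and the series is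
finite. -/
lemma integral_negBin_poissonMeasure (a : ℝ) (r : NNReal) (k : ℕ) :
    ∫ c, negBin a c k ∂poissonMeasure r
      = ∑ c ∈ Finset.range (k + 1), Real.exp (-r) * r ^ c / c.factorial * negBin a c k := by
  rw [integral_poissonMeasure, tsum_eq_sum (s := Finset.range (k + 1))]
  · rfl
  · intro c hc
    rw [negBin_eq_zero_of_lt a (by simpa using hc), smul_zero]

lemma nodeKernel_eq_sum (lam a : ℝ) (θ β : ℂ) (k : ℕ) (s : ℝ) :
    Complex.exp (-β * s) * nodeKernel lam a θ k s
      = ∑ c ∈ Finset.range (k + 1), ((negBin a c k : ℂ) * lam ^ c)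
          * ((s : ℂ) ^ c / (c.factorial : ℂ) * Complex.exp (-((lam + (β + θ)) * s))) := by
  rw [nodeKernel, nodeProb]
  push_cast
  rw [Finset.mul_sum, Finset.mul_sum]
  refine Finset.sum_congr rfl fun c _ => ?_
  rw [show -(((lam : ℂ) + (β + θ)) * s) = -β * s + (-θ * s + -(lam * s)) by ring, Complex.exp_add,
    Complex.exp_add, mul_pow]
  ring

/-- Used at `β = μ` for the exponential window and at `β = 0` for the sum over all observation
times. -/
lemma integral_exp_mul_nodeKernel {lam : ℝ} (hlam : 0 < lam) (a : ℝ) {θ β : ℂ} (hθ : 0 ≤ θ.re)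
    (hβ : 0 ≤ β.re) (k : ℕ) :
    IntegrableOn (fun s : ℝ => Complex.exp (-β * s) * nodeKernel lam a θ k s) (Ioi 0) ∧
    ∫ s in Ioi (0 : ℝ), Complex.exp (-β * s) * nodeKernel lam a θ k s
      = nodeLaplace lam a (β + θ) k := by
  have hre : 0 < ((lam : ℂ) + (β + θ)).re := by simpa using by linarith
  have hi : ∀ c ∈ Finset.range (k + 1), IntegrableOn (fun s : ℝ => ((negBin a c k : ℂ) * lam ^ c)
      * ((s : ℂ) ^ c / (c.factorial : ℂ) * Complex.exp (-((lam + (β + θ)) * s)))) (Ioi 0) :=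
    fun c _ => (integrableOn_pow_mul_exp_neg_Ioi c _ hre).const_mul _
  simp_rw [nodeKernel_eq_sum]
  refine ⟨integrable_finsetSum _ hi, ?_⟩
  rw [integral_finsetSum _ hi, nodeLaplace]
  refine Finset.sum_congr rfl fun c _ => ?_
  rw [integral_const_mul, integral_pow_mul_exp_neg_Ioi c _ hre, div_eq_mul_inv]

section Model

variable {Ω : Type*} [MeasurableSpace Ω] {P : Measure Ω}
  {lam mu a xi : ℝ} {t : ℕ → Ω → ℝ} {n : ℕ → Ω → ℕ} {w : ℕ → ℕ → Ω → ℝ} {D : ℕ → Ω → ℝ}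

/-- The losses in adjacent time intervals are independent. -/
lemma IsPoissonProcess.integral_negBin_mul_negBin (h : IsPoissonProcess P lam t) (hlam : 0 < lam)
    (a : ℝ) {s δ : ℝ} (hs : 0 ≤ s) (hδ : 0 ≤ δ) (k j : ℕ) :
    ∫ ω, negBin a (indicesIn (fun k => t k ω) (Icc 0 s)).card k
        * negBin a (indicesIn (fun k => t k ω) (Ioc s (s + δ))).card j ∂P
      = nodeProb lam a s k * nodeProb lam a δ j := by
  have hsub : Ioc s (s + δ) ⊆ Ici 0 := fun x hx => hs.trans hx.1.le
  have hind : IndepFun (pointCount t (Icc 0 s)) (pointCount t (Ioc s (s + δ))) P := by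
    have := h.count_indep 2 ![Icc 0 s, Ioc s (s + δ)]
      (by simp [Fin.forall_fin_two])
      (by simp only [Fin.forall_fin_two]; exact ⟨Icc_subset_Ici_self, hsub⟩)
      (by simp [Fin.forall_fin_two])
      (by
        intro i j hij
        fin_cases i <;> fin_cases j
        · exact absurd rfl hij
        · exact disjoint_Icc_Ioc 0 s (s + δ)
        · exact (disjoint_Icc_Ioc 0 s (s + δ)).symm
        · exact absurd rfl hij)
    exact this.indepFun (i := 0) (j := 1) (by simp)
  have hl : ∀ S : Set ℝ, MeasurableSet S → S ⊆ Ici 0 → ∀ r, 0 ≤ r → volume S = ENNReal.ofReal r →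
      AEMeasurable (pointCount t S) P ∧
      ∀ k, ∫ ω, negBin a (pointCount t S ω) k ∂P = nodeProb lam a r k := fun S hS hS' r hr hv => by
    have hlaw := h.count_law S hS hS' (by simp [hv])
    refine ⟨hlaw.aemeasurable, fun k => ?_⟩
    have := hlaw.integral_comp (f := fun c => negBin a c k) (by fun_prop)
    refine this.trans ?_
    rw [integral_negBin_poissonMeasure, hv, ENNReal.toReal_ofReal hr,
      Real.coe_toNNReal _ (mul_nonneg hlam.le hr), nodeProb]
  obtain ⟨m1, e1⟩ := hl (Icc 0 s) measurableSet_Icc Icc_subset_Ici_self s hs (by simp)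
  obtain ⟨m2, e2⟩ := hl (Ioc s (s + δ)) measurableSet_Ioc hsub δ hδ (by simp)
  simp_rw [← pointCount_eq_card]
  rw [← e1, ← e2]
  exact hind.integral_fun_comp_mul_comp (f := fun c => negBin a c k) (g := fun c => negBin a c j)
    m1 m2 (by fun_prop) (by fun_prop)

lemma measurable_obsTime (hD : ∀ i, Measurable (D i)) (i : ℕ) : Measurable (obsTime D i) := by
  unfold obsTime
  fun_prop

lemma abs_negBin_le_one {a : ℝ} (ha : 0 ≤ a) (ha' : a ≤ 1) : ∀ c k, |negBin a c k| ≤ 1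
  | 0, 0 => by simp [negBin]
  | 0, _ + 1 => by simp [negBin]
  | _ + 1, 0 => by simp [negBin]
  | c + 1, k + 1 => by
    have h1 := abs_le.1 (abs_negBin_le_one ha ha' c k)
    have h2 := abs_le.1 (abs_negBin_le_one ha ha' (c + 1) k)
    rw [negBin, abs_le]
    constructor <;> nlinarith

lemma IsModelTwo.indepFun_obsTime (h : IsModelTwo P lam mu a xi t n w D) (i : ℕ) :
    IndepFun (obsTime D i) (D (i + 1)) P := by
  have := h.obs_indep.indepFun_finsetSum_of_notMem h.obs_measurable
    (s := Finset.range (i + 1)) (i := i + 1) (by simp)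
  convert this using 1
  ext ω
  simp [obsTime]

/-- Averaging over the attack times and over the two time intervals. -/
lemma IsModelTwo.integral_negBin_mul_exp [IsProbabilityMeasure P]
    (h : IsModelTwo P lam mu a xi t n w D)
    (hlam : 0 < lam) (ha : 0 < a) (ha' : a ≤ 1) {θ : ℂ} (hθ : 0 ≤ θ.re) (i k j : ℕ) :
    ∫ ω, (negBin a (indicesIn (fun k => t k ω) (Icc 0 (obsTime D i ω))).card k
        * negBin a (indicesIn (fun k => t k ω) (Ioc (obsTime D i ω) (obsTime D (i + 1) ω))).card j
          : ℂ) * Complex.exp (-θ * obsTime D (i + 1) ω) ∂P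
      = (∫ ω, nodeKernel lam a θ k (obsTime D i ω) ∂P)
        * ∫ ω, nodeKernel lam a θ j (D (i + 1) ω) ∂P := by
  have htD : IndepFun (fun ω k => t k ω) (fun ω => (obsTime D i ω, D (i + 1) ω)) P := by
    have := h.indep_attacks.comp (ψ := fun p : (ℕ → ℕ) × (ℕ → ℕ → ℝ) × (ℕ → ℝ) =>
      (∑ j ∈ Finset.range (i + 1), p.2.2 j, p.2.2 (i + 1))) measurable_id (by fun_prop)
    exact this
  have ht := h.attacks.measurable
  have hD := h.obs_measurable
  have hτ := measurable_obsTime hD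
  -- The last window is written as `(τ, τ + δ]`, so that Fubini fixes the independent pair `(τ_i,
  -- Δ_{i+1})` and averages over the attacks.
  let Φ : (ℕ → ℝ) × (ℝ × ℝ) → ℂ := fun p =>
    (negBin a (indicesIn p.1 (Icc 0 p.2.1)).card k
      * negBin a (indicesIn p.1 (Ioc p.2.1 (p.2.1 + p.2.2))).card j : ℂ)
      * Complex.exp (-θ * (p.2.1 + p.2.2 : ℝ))
  have hΦ : Measurable Φ := by
    have hf : ∀ k, Measurable fun A : Finset ℕ => (negBin a A.card k : ℂ) :=
      fun k => measurable_of_countable _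
    refine Measurable.mul (Measurable.mul ((hf k).comp (measurable_indicesIn fun k => ?_))
      ((hf j).comp (measurable_indicesIn fun k => ?_))) (by fun_prop)
    · exact (measurableSet_le (f := fun _ => (0 : ℝ)) (by fun_prop) (by fun_prop)).inter
        (measurableSet_le (f := fun p : (ℕ → ℝ) × (ℝ × ℝ) => p.1 k) (by fun_prop) (by fun_prop))
    · exact (measurableSet_lt (f := fun p : (ℕ → ℝ) × (ℝ × ℝ) => p.2.1)
          (by fun_prop) (by fun_prop)).inter
        (measurableSet_le (f := fun p : (ℕ → ℝ) × (ℝ × ℝ) => p.1 k) (by fun_prop) (by fun_prop))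
  have hreg := h.ae_isRegular
  have hX : Measurable fun ω k => t k ω := by fun_prop
  have hY : Measurable fun ω => (obsTime D i ω, D (i + 1) ω) := (hτ i).prodMk (hD _)
  have hint : Integrable (fun ω => Φ (fun k => t k ω, (obsTime D i ω, D (i + 1) ω))) P := by
    refine Integrable.of_bound (hΦ.comp (hX.prodMk hY)).aestronglyMeasurable 1
      (hreg.mono fun ω hω => ?_)
    simp only [Φ, norm_mul, Complex.norm_real, Real.norm_eq_abs]
    refine mul_le_one₀ (mul_le_one₀ (abs_negBin_le_one ha.le ha' _ _) (abs_nonneg _)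
      (abs_negBin_le_one ha.le ha' _ _)) (norm_nonneg _) (norm_exp_neg_mul_le_one hθ ?_)
    exact add_nonneg (hω.obsTime_nonneg i) (hω.obs_nonneg _)
  have hfub := integral_indepFun hX hY htD hΦ hint
  simp only [obsTime_succ]
  refine hfub.trans ?_
  have hae : ∀ᵐ ω ∂P, ∫ ω', Φ (fun k => t k ω', (obsTime D i ω, D (i + 1) ω)) ∂P
      = nodeKernel lam a θ k (obsTime D i ω) * nodeKernel lam a θ j (D (i + 1) ω) := by
    filter_upwards [hreg] with ω hω
    simp only [Φ]
    rw [integral_mul_const]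
    have := h.attacks.integral_negBin_mul_negBin hlam a (hω.obsTime_nonneg i)
      (hω.obs_nonneg (i + 1)) k j
    simp_rw [← Complex.ofReal_mul]
    rw [integral_complex_ofReal, this, nodeKernel, nodeKernel]
    push_cast
    rw [show -θ * ((obsTime D i ω : ℂ) + D (i + 1) ω)
      = -θ * obsTime D i ω + -θ * D (i + 1) ω by ring, Complex.exp_add]
    ring
  rw [integral_congr_ae hae]
  exact (h.indepFun_obsTime i).integral_fun_comp_mul_comp (hτ i).aemeasurable
    (hD _).aemeasurable (continuous_nodeKernel lam a θ k).aestronglyMeasurable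
    (continuous_nodeKernel lam a θ j).aestronglyMeasurable

/-- The contribution of an increment. -/
lemma IsModelTwo.integral_nodeKernel_obs (h : IsModelTwo P lam mu a xi t n w D)
    (hlam : 0 < lam) (hmu : 0 < mu) {θ : ℂ} (hθ : 0 ≤ θ.re) (i j : ℕ) :
    ∫ ω, nodeKernel lam a θ j (D (i + 1) ω) ∂P = mu * nodeLaplace lam a (mu + θ) j := by
  have h1 := (h.obs_law i).integral_comp (f := nodeKernel lam a θ j)
    (continuous_nodeKernel lam a θ j).aestronglyMeasurable
  have h2 := (integral_exp_mul_nodeKernel hlam a hθ (β := mu) (by simpa using hmu.le) j).2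
  refine h1.trans ?_
  rw [integral_expMeasure hmu, ← h2, ← integral_const_mul]
  congr 1 with s
  push_cast
  ring_nf

/-- The sum of the contributions of the observation times before the exit. -/
lemma IsModelTwo.hasSum_integral_nodeKernel [IsProbabilityMeasure P]
    (h : IsModelTwo P lam mu a xi t n w D)
    (hlam : 0 < lam) (hmu : 0 < mu) {θ : ℂ} (hθ : 0 ≤ θ.re) (k : ℕ) :
    HasSum (fun i => ∫ ω, nodeKernel lam a θ k (obsTime D i ω) ∂P)
      ((if k = 0 then 1 else 0) + mu * nodeLaplace lam a θ k) := by
  have hk := integral_exp_mul_nodeKernel hlam a hθ (β := 0) (by simp) k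
  simp only [neg_zero, zero_mul, Complex.exp_zero, one_mul, zero_add] at hk
  have hm := continuous_nodeKernel lam a θ k
  have hs := hasSum_integral_gammaMeasure hmu hm.measurable hk.1
  rw [hk.2] at hs
  have h0 : ∫ ω, nodeKernel lam a θ k (obsTime D 0 ω) ∂P = if k = 0 then 1 else 0 := by
    rw [← nodeKernel_zero lam a θ k, integral_congr_ae (g := fun _ => nodeKernel lam a θ k 0)]
    · simp
    · exact h.ae_isRegular.mono fun ω hω => by simp only [hω.obsTime_zero]
  -- Since `D 0` vanishes almost surely, `τ_{i+1}` is a sum of `i + 1` exponential variables.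
  have hsucc : ∀ i : ℕ, ∫ ω, nodeKernel lam a θ k (obsTime D (i + 1) ω) ∂P
      = ∫ x, nodeKernel lam a θ k x ∂gammaMeasure (i + 1) mu := fun i => by
    have hT : (Finset.Icc 1 (i + 1)).card = i + 1 := by simp
    rw [← map_sum_eq_gammaMeasure hmu h.obs_measurable h.obs_indep (T := Finset.Icc 1 (i + 1))
      (fun j hj => ?_) hT, integral_map _ hm.aestronglyMeasurable]
    · refine integral_congr_ae (h.ae_isRegular.mono fun ω hω => ?_)
      simp only [obsTime]
      rw [Finset.sum_range_succ', hω.obs_zero, add_zero, Finset.sum_apply,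
        ← Finset.Ico_add_one_right_eq_Icc, Finset.sum_Ico_eq_sum_range]
      simp [add_comm]
    · have := h.obs_measurable
      fun_prop
    · obtain ⟨l, rfl⟩ : ∃ l, j = l + 1 := ⟨j - 1, by have := Finset.mem_Icc.1 hj; omega⟩
      exact h.obs_law l
  rw [← h0, add_comm]
  refine (hasSum_nat_add_iff' 1).1 ?_
  simpa [hsucc] using hs

end Model

/-! ### The exit -/

section Model

variable {Ω : Type*} {t : ℕ → Ω → ℝ} {n : ℕ → Ω → ℕ} {w : ℕ → ℕ → Ω → ℝ} {D : ℕ → Ω → ℝ}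

/-- The attacks up to the `i`-th observation, and those between it and the following one. -/
noncomputable def attackSets (t : ℕ → Ω → ℝ) (D : ℕ → Ω → ℝ) (i : ℕ) (ω : Ω) :
    Finset ℕ × Finset ℕ :=
  (indicesIn (fun k => t k ω) (Icc 0 (obsTime D i ω)),
    indicesIn (fun k => t k ω) (Ioc (obsTime D i ω) (obsTime D (i + 1) ω)))

/-- The contribution of the event that the exit takes place at the observation `i + 1`. -/
noncomputable def exitTerm (t : ℕ → Ω → ℝ) (n : ℕ → Ω → ℕ) (w : ℕ → ℕ → Ω → ℝ) (D : ℕ → Ω → ℝ)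
    (L M : ℕ) (V : ℝ) (u v θ : ℂ) (i : ℕ) (ω : Ω) : ℂ :=
  lossFactor L M V u v ((fun k => n k ω, fun k j => w k j ω), attackSets t D i ω)
    * Complex.exp (-θ * obsTime D (i + 1) ω)

lemma IsRegular.norm_exitTerm_le_one {ω : Ω} (h : IsRegular t w D ω) (L M : ℕ) (V : ℝ) {u v θ : ℂ}
    (hu : ‖u‖ ≤ 1) (hv : 0 ≤ v.re) (hθ : 0 ≤ θ.re) (i : ℕ) :
    ‖exitTerm t n w D L M V u v θ i ω‖ ≤ 1 := by
  rw [exitTerm, norm_mul]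
  exact mul_le_one₀ (norm_lossFactor_le_one L M V hu hv _ h.weights_nonneg) (norm_nonneg _)
    (norm_exp_neg_mul_le_one hθ (h.obsTime_nonneg _))

-- As the node loss is nondecreasing, staying at or below `L` before observation `i + 1` is a
-- condition on observation `i` alone.
open Classical in
lemma IsRegular.exitTerm_eq {ω : Ω} (h : IsRegular t w D ω) (L M : ℕ) (V : ℝ) (u v θ : ℂ)
    (i : ℕ) :
    exitTerm t n w D L M V u v θ i ω
      = if (∀ j < i + 1, nodeLoss t n D j ω ≤ L) ∧ L < nodeLoss t n D (i + 1) ω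
            ∧ nodeLoss t n D (i + 1) ω ≤ M ∧ weightLoss t n w D (i + 1) ω ≤ V then
          u ^ nodeLoss t n D (i + 1) ω * Complex.exp (-v * (weightLoss t n w D (i + 1) ω : ℂ))
            * Complex.exp (-θ * (obsTime D (i + 1) ω : ℂ))
        else 0 := by
  have hlt : (∀ j < i + 1, nodeLoss t n D j ω ≤ L) ↔ nodeLoss t n D i ω ≤ L :=
    ⟨fun h' => h' i i.lt_succ_self,
      fun h' j hj => (h.nodeLoss_mono (n := n) (Nat.le_of_lt_succ hj)).trans h'⟩
  have hsum : ∑ k ∈ (attackSets t D i ω).1, n k ω + ∑ k ∈ (attackSets t D i ω).2, n k ω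
      = nodeLoss t n D (i + 1) ω := by
    rw [h.nodeLoss_eq (i + 1), h.indicesIn_Icc_union,
      Finset.sum_union (disjoint_indicesIn _ (disjoint_Icc_Ioc _ _ _))]
    rfl
  have hW : ∑ k ∈ (attackSets t D i ω).1 ∪ (attackSets t D i ω).2,
      ∑ j ∈ Finset.range (n k ω), w k j ω = weightLoss t n w D (i + 1) ω := by
    rw [h.weightLoss_eq (i + 1), h.indicesIn_Icc_union]
    rfl
  have hN : ∑ k ∈ (attackSets t D i ω).1, n k ω = nodeLoss t n D i ω := (h.nodeLoss_eq i).symm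
  rw [hN] at hsum
  simp only [exitTerm, lossFactor, nodeFactor, weightFactor, hsum, hW, hlt, hN, indicator_apply,
    mem_Iic]
  split_ifs <;> first | tauto | simp

/-- At a regular sample point the marked exit is the only nonzero one among the contributions of
the observations. -/
lemma IsRegular.hasSum_exitTerm {E : Type*} [AddCommGroup E] [TopologicalSpace E]
    [IsTopologicalAddGroup E] {f : ℂ → E} (hf : f 0 = 0) {ω : Ω} (h : IsRegular t w D ω) (L M : ℕ)
    (V : ℝ) (u v θ : ℂ) :
    HasSum (fun i => f (exitTerm t n w D L M V u v θ i ω))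
      (f (strictExit t n w D L M V u v θ ω)) := by
  classical
  have hs := hasSum_exitIndex (h.nodeLoss_mono (n := n)) (h.weightLoss_mono (n := n)) L M V
    (fun i => f (u ^ nodeLoss t n D i ω * Complex.exp (-v * (weightLoss t n w D i ω : ℂ))
      * Complex.exp (-θ * (obsTime D i ω : ℂ))))
  -- No exit can occur at observation `0`, where the loss is zero, so the index shifts by one.
  have h0 := (hasSum_nat_add_iff' 1).2 hs
  have hz : ¬ L < nodeLoss t n D 0 ω := by simp [h.nodeLoss_zero]
  simp only [Finset.sum_range_one, hz, false_and, and_false, if_false, sub_zero] at h0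
  rw [strictExit, markedExit, indicator_apply]
  convert! h0 using 1
  · ext i
    rw [h.exitTerm_eq, apply_ite f, hf]
  · rw [apply_ite f, hf]
    rfl

lemma IsRegular.norm_strictExit_le_one {ω : Ω} (h : IsRegular t w D ω) (L M : ℕ) (V : ℝ)
    {u v θ : ℂ} (hu : ‖u‖ ≤ 1) (hv : 0 ≤ v.re) (hθ : 0 ≤ θ.re) :
    ‖strictExit t n w D L M V u v θ ω‖ ≤ 1 := by
  classical
  rw [strictExit, markedExit, indicator_apply]
  split_ifs
  · rw [norm_mul, norm_mul, norm_pow]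
    exact mul_le_one₀ (mul_le_one₀ (pow_le_one₀ (norm_nonneg _) hu) (norm_nonneg _)
      (norm_exp_neg_mul_le_one hv (h.weightLoss_nonneg _))) (norm_nonneg _)
      (norm_exp_neg_mul_le_one hθ (h.obsTime_nonneg _))
  · simp

variable [MeasurableSpace Ω] {P : Measure Ω} {lam mu a xi : ℝ}

lemma measurable_attackSets (ht : ∀ k, Measurable (t k)) (hD : ∀ i, Measurable (D i)) (i : ℕ) :
    Measurable (attackSets t D i) := by
  have hτ := measurable_obsTime hD
  have hle := fun k => measurableSet_le (measurable_const (a := (0 : ℝ))) (ht k)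
  exact (measurable_indicesIn (x := fun ω k => t k ω) (S := fun ω => Icc 0 (obsTime D i ω))
      fun k => (hle k).inter (measurableSet_le (ht k) (hτ i))).prodMk
    (measurable_indicesIn (x := fun ω k => t k ω)
      (S := fun ω => Ioc (obsTime D i ω) (obsTime D (i + 1) ω))
      fun k => (measurableSet_lt (hτ i) (ht k)).inter (measurableSet_le (ht k) (hτ (i + 1))))

lemma IsModelTwo.measurable_exitTerm (h : IsModelTwo P lam mu a xi t n w D) (L M : ℕ) (V : ℝ)
    (u v θ : ℂ) (i : ℕ) : Measurable (exitTerm t n w D L M V u v θ i) := by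
  have hn := h.nodes_measurable
  have hw := h.weights_measurable
  have hτ := measurable_obsTime h.obs_measurable (i + 1)
  have hA := measurable_attackSets h.attacks.measurable h.obs_measurable i
  exact ((measurable_lossFactor L M V u v).comp
    ((by fun_prop : Measurable fun ω => ((fun k => n k ω : ℕ → ℕ),
      (fun k j => w k j ω : ℕ → ℕ → ℝ))).prodMk hA)).mul (by fun_prop)

variable [IsProbabilityMeasure P]

/-- Separates the sizes of the losses from all the times, so that the losses can be averaged with
the times held fixed. -/
lemma IsModelTwo.indepFun_losses (h : IsModelTwo P lam mu a xi t n w D) :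
    IndepFun (fun ω => ((fun k => n k ω : ℕ → ℕ), (fun k j => w k j ω : ℕ → ℕ → ℝ)))
      (fun ω => ((fun k => t k ω : ℕ → ℝ), (fun i => D i ω : ℕ → ℝ))) P := by
  have ht := h.attacks.measurable
  have hn := h.nodes_measurable
  have hw := h.weights_measurable
  have hD := h.obs_measurable
  have h1 : IndepFun (fun ω k => n k ω)
      (fun ω => ((fun i => D i ω : ℕ → ℝ), (fun k j => w k j ω : ℕ → ℕ → ℝ))) P :=
    h.indep_nodes.comp measurable_id measurable_swap
  have h2 := (indepFun_prodMk_of_indepFun (by fun_prop) (by fun_prop) (by fun_prop) h1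
    h.indep_weights.symm).symm
  have h3 : IndepFun (fun ω k => t k ω)
      (fun ω => (((fun k => n k ω : ℕ → ℕ), (fun k j => w k j ω : ℕ → ℕ → ℝ)),
        (fun i => D i ω : ℕ → ℝ))) P :=
    h.indep_attacks.comp (ψ := fun p : (ℕ → ℕ) × (ℕ → ℕ → ℝ) × (ℕ → ℝ) => ((p.1, p.2.1), p.2.2))
      measurable_id (by fun_prop)
  exact indepFun_prodMk_of_indepFun (by fun_prop) (by fun_prop) (by fun_prop) h3 h2

/-- Fubini first averages the losses for fixed index sets, then the times. The result depends on `i`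
only through the law of `τ_i`. -/
lemma integral_exitTerm (h : IsModelTwo P lam mu a xi t n w D) (hlam : 0 < lam) (hmu : 0 < mu)
    (ha : 0 < a) (ha' : a ≤ 1) (hxi : 0 < xi) {V : ℝ} (hV : 0 ≤ V) (L M : ℕ) {u v θ : ℂ}
    (hu : ‖u‖ ≤ 1) (hv : 0 ≤ v.re) (hθ : 0 ≤ θ.re) (i : ℕ) :
    ∫ ω, exitTerm t n w D L M V u v θ i ω ∂P
      = ∑ m ∈ Finset.Ioc L M, ∑ k ∈ Finset.range (L + 1), u ^ m * weightTransform xi V v m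
          * ((∫ ω, nodeKernel lam a θ k (obsTime D i ω) ∂P)
            * (mu * nodeLaplace lam a (mu + θ) (m - k))) := by
  have ht := h.attacks.measurable
  have hn := h.nodes_measurable
  have hw := h.weights_measurable
  have hD := h.obs_measurable
  have hreg := h.ae_isRegular
  have hτ := measurable_obsTime hD
  have hA := measurable_attackSets ht hD i
  have hind : IndepFun (fun ω => ((fun k => n k ω : ℕ → ℕ), (fun k j => w k j ω : ℕ → ℕ → ℝ)))
      (fun ω => (attackSets t D i ω, obsTime D (i + 1) ω)) P := by
    have hD' : ∀ j, Measurable fun p : (ℕ → ℝ) × (ℕ → ℝ) => p.2 j := fun j => by fun_prop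
    exact h.indepFun_losses.comp
      (ψ := fun p : (ℕ → ℝ) × (ℕ → ℝ) => (attackSets (fun k (p : (ℕ → ℝ) × (ℕ → ℝ)) => p.1 k)
          (fun j (p : (ℕ → ℝ) × (ℕ → ℝ)) => p.2 j) i p,
        obsTime (fun j (p : (ℕ → ℝ) × (ℕ → ℝ)) => p.2 j) (i + 1) p)) measurable_id
      ((measurable_attackSets (fun k => by fun_prop) hD' i).prodMk (measurable_obsTime hD' _))
  have hΦ : Measurable fun p : ((ℕ → ℕ) × (ℕ → ℕ → ℝ)) × ((Finset ℕ × Finset ℕ) × ℝ) =>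
      lossFactor L M V u v (p.1, p.2.1) * Complex.exp (-θ * p.2.2) :=
    ((measurable_lossFactor L M V u v).comp (by fun_prop)).mul (by fun_prop)
  have hint : Integrable (exitTerm t n w D L M V u v θ i) P :=
    Integrable.of_bound (h.measurable_exitTerm L M V u v θ i).aestronglyMeasurable 1
      (hreg.mono fun ω hω => hω.norm_exitTerm_le_one L M V hu hv hθ i)
  refine (integral_indepFun (by fun_prop) (hA.prodMk (hτ _)) hind hΦ hint).trans ?_
  have hinner : ∀ ω, ∫ ω', lossFactor L M V u v ((fun k => n k ω', fun k j => w k j ω'),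
        attackSets t D i ω) * Complex.exp (-θ * obsTime D (i + 1) ω) ∂P
      = ∑ m ∈ Finset.Ioc L M, ∑ k ∈ Finset.range (L + 1), u ^ m * weightTransform xi V v m
          * ((negBin a (attackSets t D i ω).1.card k
            * negBin a (attackSets t D i ω).2.card (m - k) : ℂ)
              * Complex.exp (-θ * obsTime D (i + 1) ω)) := fun ω => by
    have := h.integral_lossFactor ha ha' hxi hV L M hu hv
      (disjoint_indicesIn (fun k => t k ω)
        (disjoint_Icc_Ioc 0 (obsTime D i ω) (obsTime D (i + 1) ω)))
    rw [integral_mul_const]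
    refine (congrArg (· * _) this).trans ?_
    simp only [Finset.sum_mul]
    refine Finset.sum_congr rfl fun m _ => Finset.sum_congr rfl fun k _ => ?_
    simp only [attackSets]
    ring
  simp_rw [hinner]
  have hf : ∀ k, Measurable fun A : Finset ℕ => (negBin a A.card k : ℂ) :=
    fun k => measurable_of_countable _
  have hterm : ∀ m k : ℕ, Integrable (fun ω => u ^ m * weightTransform xi V v m
      * ((negBin a (attackSets t D i ω).1.card k
        * negBin a (attackSets t D i ω).2.card (m - k) : ℂ)
          * Complex.exp (-θ * obsTime D (i + 1) ω))) P := fun m k => by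
    refine (Integrable.of_bound (Measurable.aestronglyMeasurable ?_) 1
      (hreg.mono fun ω hω => ?_)).const_mul _
    · exact (((hf k).comp hA.fst).mul ((hf (m - k)).comp hA.snd)).mul
        (by have := hτ (i + 1); fun_prop)
    · simp only [norm_mul, Complex.norm_real, Real.norm_eq_abs]
      exact mul_le_one₀ (mul_le_one₀ (abs_negBin_le_one ha.le ha' _ _) (abs_nonneg _)
        (abs_negBin_le_one ha.le ha' _ _)) (norm_nonneg _)
        (norm_exp_neg_mul_le_one hθ (hω.obsTime_nonneg _))
  rw [integral_finsetSum _ fun m _ => integrable_finsetSum _ fun k _ => hterm m k]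
  refine Finset.sum_congr rfl fun m _ => ?_
  rw [integral_finsetSum _ fun k _ => hterm m k]
  refine Finset.sum_congr rfl fun k _ => ?_
  rw [integral_const_mul]
  congr 1
  rw [← h.integral_nodeKernel_obs hlam hmu hθ i]
  exact h.integral_negBin_mul_exp hlam ha ha' hθ i k (m - k)

/-- Summing over `i` turns the factor from `τ_i` into the renewal sequence, whose convolution with
the last increment telescopes. -/
lemma hasSum_integral_exitTerm (h : IsModelTwo P lam mu a xi t n w D) (hlam : 0 < lam)
    (hmu : 0 < mu) (ha : 0 < a) (ha' : a ≤ 1) (hxi : 0 < xi) {V : ℝ} (hV : 0 ≤ V) (L M : ℕ)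
    {u v θ : ℂ} (hu : ‖u‖ ≤ 1) (hv : 0 ≤ v.re) (hθ : 0 ≤ θ.re) :
    HasSum (fun i => ∫ ω, exitTerm t n w D L M V u v θ i ω ∂P)
      (exitSum lam mu a xi V L M u v θ) := by
  simp_rw [fun i => integral_exitTerm h hlam hmu ha ha' hxi hV L M hu hv hθ i]
  have h1 : (lam : ℂ) + θ ≠ 0 := fun h0 => by
    have := congrArg Complex.re h0
    simp only [Complex.add_re, Complex.ofReal_re, Complex.zero_re] at this
    linarith
  have h2 : (lam : ℂ) + (mu + θ) ≠ 0 := fun h0 => by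
    have := congrArg Complex.re h0
    simp only [Complex.add_re, Complex.ofReal_re, Complex.zero_re] at this
    linarith
  unfold exitSum
  refine hasSum_sum fun m hm => ?_
  have hm' := Finset.mem_Ioc.1 hm
  have key := sum_renewal_mul_increment lam mu a θ h1 h2 L (m - (L + 1))
  rw [show L + 1 + (m - (L + 1)) = m by omega] at key
  rw [← key, mul_assoc, mul_comm (Finset.sum _ _), ← weightTransform, Finset.mul_sum]
  exact hasSum_sum fun k _ => ((h.hasSum_integral_nodeKernel hlam hmu hθ k).mul_right _).mul_left _

/-- Measurability comes from the almost sure limit of partial sums of exit terms, without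
measurability of the exit indices. -/
lemma IsModelTwo.integrable_strictExit (h : IsModelTwo P lam mu a xi t n w D) (L M : ℕ) (V : ℝ)
    {u v θ : ℂ} (hu : ‖u‖ ≤ 1) (hv : 0 ≤ v.re) (hθ : 0 ≤ θ.re) :
    Integrable (strictExit t n w D L M V u v θ) P := by
  refine Integrable.of_bound (aestronglyMeasurable_of_tendsto_ae atTop
    (f := fun N ω => ∑ i ∈ Finset.range N, exitTerm t n w D L M V u v θ i ω) (fun N => ?_) ?_) 1 ?_
  · exact (Finset.measurable_sum _ fun i _ =>
      h.measurable_exitTerm L M V u v θ i).aestronglyMeasurable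
  · exact h.ae_isRegular.mono fun ω hω =>
      (hω.hasSum_exitTerm (f := id) rfl L M V u v θ).tendsto_sum_nat
  · exact h.ae_isRegular.mono fun ω hω => hω.norm_strictExit_le_one L M V hu hv hθ

/-- At most one exit term is nonzero, so the norms of the terms add up to the norm of the marked
exit, which is integrable and justifies the interchange. -/
lemma IsModelTwo.integral_strictExit (h : IsModelTwo P lam mu a xi t n w D) (hlam : 0 < lam)
    (hmu : 0 < mu) (ha : 0 < a) (ha' : a ≤ 1) (hxi : 0 < xi) {V : ℝ} (hV : 0 ≤ V) (L M : ℕ)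
    {u v θ : ℂ} (hu : ‖u‖ ≤ 1) (hv : 0 ≤ v.re) (hθ : 0 ≤ θ.re) :
    ∫ ω, strictExit t n w D L M V u v θ ω ∂P = exitSum lam mu a xi V L M u v θ := by
  refine HasSum.unique ?_ (hasSum_integral_exitTerm h hlam hmu ha ha' hxi hV L M hu hv hθ)
  have hnorm : ∀ᵐ ω ∂P, HasSum (fun i => ‖exitTerm t n w D L M V u v θ i ω‖)
      ‖strictExit t n w D L M V u v θ ω‖ := h.ae_isRegular.mono fun ω hω =>
    hω.hasSum_exitTerm (f := norm) norm_zero L M V u v θ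
  refine hasSum_integral_of_dominated_convergence
    (fun i ω => ‖exitTerm t n w D L M V u v θ i ω‖)
    (fun i => (h.measurable_exitTerm L M V u v θ i).aestronglyMeasurable)
    (fun i => Eventually.of_forall fun ω => le_rfl) (hnorm.mono fun ω hω => hω.summable) ?_
    (h.ae_isRegular.mono fun ω hω => hω.hasSum_exitTerm (f := id) rfl L M V u v θ)
  exact (h.integrable_strictExit L M V hu hv hθ).norm.congr
    (hnorm.mono fun ω hω => hω.tsum_eq.symm)

end Model

end CyberAttack

theorem proposition5p1 {Ω : Type*} [MeasurableSpace Ω] (P : Measure Ω) [IsProbabilityMeasure P]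
    (lam mu a xi V : ℝ) (hlam : 0 < lam) (hmu : 0 < mu) (ha : 0 < a) (ha' : a ≤ 1) (hxi : 0 < xi)
    (hV : 0 < V) (M₁ M : ℕ) (hM₁ : 1 ≤ M₁) (hM : M₁ < M)
    (t : ℕ → Ω → ℝ) (n : ℕ → Ω → ℕ) (w : ℕ → ℕ → Ω → ℝ) (D : ℕ → Ω → ℝ)
    (hmodel : IsModelTwo P lam mu a xi t n w D)
    (u v θ : ℂ) (hu : ‖u‖ ≤ 1) (hv : 0 ≤ v.re) (hθ : 0 ≤ θ.re) :
    -- a level counts as crossed when it is exceeded: the formulas hold at `M₁ + 1`, `M + 1`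
    (Integrable (strictExit t n w D M₁ M V u v θ) P ∧
      (M₁ + 1 < M → (∫ ω, strictExit t n w D M₁ M V u v θ ω ∂P) =
        gapFormula lam mu a xi V (M₁ + 1) (M + 1) u v θ) ∧
      (M = M₁ + 1 → (∫ ω, strictExit t n w D M₁ M V u v θ ω ∂P) =
        adjacentFormula lam mu a xi V (M₁ + 1) u v θ)) ∧
    -- a node level counts as crossed when it is reached: the formulas hold at `M₁`, `M`
    (Integrable (reachExit t n w D M₁ M V u v θ) P ∧
      (M₁ + 1 < M → (∫ ω, reachExit t n w D M₁ M V u v θ ω ∂P) =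
        gapFormula lam mu a xi V M₁ M u v θ) ∧
      (M = M₁ + 1 → (∫ ω, reachExit t n w D M₁ M V u v θ ω ∂P) =
        adjacentFormula lam mu a xi V M₁ u v θ)) := by
  -- `L = 0` must be allowed: it occurs for the reaching convention with `M₁ = 1`.
  have main : ∀ L N : ℕ, L < N → Integrable (strictExit t n w D L N V u v θ) P ∧
      (∫ ω, strictExit t n w D L N V u v θ ω ∂P) = gapFormula lam mu a xi V (L + 1) (N + 1) u v θ ∧
      (N = L + 1 → (∫ ω, strictExit t n w D L N V u v θ ω ∂P) =
        adjacentFormula lam mu a xi V (L + 1) u v θ) := fun L N hLN => by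
    rw [hmodel.integral_strictExit hlam hmu ha ha' hxi hV.le L N hu hv hθ]
    refine ⟨hmodel.integrable_strictExit L N V hu hv hθ,
      exitSum_eq_gapFormula lam mu a xi V hlam hmu ha ha' hxi L N hLN u v θ hu hv hθ, ?_⟩
    rintro rfl
    exact exitSum_succ lam mu a xi V L u v θ
  rw [reachExit_eq_strictExit t n w D hM₁ (hM₁.trans hM.le)]
  obtain ⟨i1, g1, a1⟩ := main M₁ M hM
  obtain ⟨i2, g2, a2⟩ := main (M₁ - 1) (M - 1) (by omega)
  rw [Nat.sub_add_cancel hM₁] at g2 a2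
  rw [Nat.sub_add_cancel (hM₁.trans hM.le)] at g2
  exact ⟨⟨i1, fun _ => g1, a1⟩, i2, fun _ => g2, fun h => a2 (by omega)⟩
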